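/- For entire functions $f=\sum_{j\ge 0}\gamma_j x^j/j!$ and $g=\sum_{j\ge 0}\delta_j x^j/j!$ put $f*g=\sum_{j\ge 0}\gamma_j\delta_j x^j/j!$ (Schur–Szegő composition; likewise for any finite number of functions, the empty composition being $e^x$). For $a\in\mathbb C$ let $\kappa_a=e^x(1+x/a)$ if $a\ne 0$ and $\kappa_0=e^x x$. Consider real polynomials $R\neq 0$, $d=\deg R$, together with numbers $a_1,\dots,a_d\in\mathbb C$, the set of which (with multiplicities) is invariant under complex conjugation, such that $e^xR=\kappa_{a_1}*\cdots*\kappa_{a_d}$, the non-zero roots of $R$ are pairwise distinct and the non-zero $a_i$ are pairwise distinct. For each of the following tables, and for all non-negative integers satisfying the stated conditions, there exist such $R$ and $a_1,\dots,a_d$ for which the numbers of negative, zero, positive and non-real roots of $R$ (counted with multiplicity), and the numbers of negative, zero, positive and non-real ones among $-a_1,\dots,-a_d$, are as listed. Case 1) ($k,q\ge 1$; $k_{\mathbb C},q_{\mathbb C}$ even.) Roots of $R$: $q-1+q_1+q_{\mathbb C}+k_1$ negative, $k$ zero, $m$ positive, $k_{\mathbb C}$ non-real. Numbers $-a_i$: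 $q_1$ negative, $q$ zero, $k-1+m+k_{\mathbb C}+k_1$ positive, $q_{\mathbb C}$ non-real. Case 2) ($k_{\mathbb C},q_{\mathbb C}$ and $r:=k_{\mathbb C}+k_1$ even.) Roots of $R$: $q_1+q_{\mathbb C}+k_1$ negative, $0$ zero, $m$ positive, $k_{\mathbb C}$ non-real. Numbers $-a_i$: $q_1$ negative, $0$ zero, $m+k_{\mathbb C}+k_1$ positive, $q_{\mathbb C}$ non-real. Case 3) ($k,q\ge 1$; $\delta\ge 1$; $r+\delta$, $s+\delta$ even.) Roots of $R$: $q-1+q_1+s$ negative, $k$ zero, $m$ positive, $r+\delta$ non-real. Numbers $-a_i$: $q_1$ negative, $q$ zero, $k-1+m+r$ positive, $s+\delta$ non-real. Case 4) ($\delta\ge 1$; $r+\delta$, $s+\delta$ and $r$ even.) Roots of $R$: $q_1+s$ negative, $0$ zero, $m$ positive, $r+\delta$ non-real. Numbers $-a_i$: $q_1$ negative, $0$ zero, $m+r$ positive, $s+\delta$ non-real. -/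

import Mathlib

open Polynomial

/-- The `j`-th coefficient `γ_j` in the expansion `f(x) = ∑ γ_j x^j / j!` of an entire function. -/
noncomputable def expCoeff (f : ℂ → ℂ) (j : ℕ) : ℂ := iteratedDeriv j f 0

/-- `f` is the Schur-Szegő composition of the finitely many entire functions `g i`:
the series `∑ (∏ i, γ_j (g i)) x^j / j!` converges everywhere and its sum is `f`.
(For the empty family this says that `f` is the unity `e^x`.) -/
structure IsSchurSzegoComposition {ι : Type*} [Fintype ι] (f : ℂ → ℂ) (g : ι → ℂ → ℂ) : Prop where
  entire : ∀ i, Differentiable ℂ (g i)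
  hasSum : ∀ x : ℂ,
    HasSum (fun j : ℕ => (∏ i, expCoeff (g i) j) * x ^ j / (Nat.factorial j : ℂ)) (f x)

open Classical in
/-- The composition factor `κ_a`: it is `e^x (1 + x/a)` for `a ≠ 0`, and `e^x x` for `a = 0`. -/
noncomputable def kappa (a : ℂ) (x : ℂ) : ℂ :=
  Complex.exp x * (if a = 0 then x else 1 + x / a)

open Classical in
/-- A finite collection of complex numbers (with multiplicities) consists of `nneg` negative
numbers, `nzero` zeros, `npos` positive numbers and `ncplx` non-real numbers, is invariant under
complex conjugation, and its non-zero members are pairwise distinct. -/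
structure HasCounts (M : Multiset ℂ) (nneg nzero npos ncplx : ℕ) : Prop where
  card_neg : M.countP (fun z => z.im = 0 ∧ z.re < 0) = nneg
  card_zero : M.count 0 = nzero
  card_pos : M.countP (fun z => z.im = 0 ∧ 0 < z.re) = npos
  card_cplx : M.countP (fun z => z.im ≠ 0) = ncplx
  conj_invariant : M.map (starRingEnd ℂ) = M
  distinct : ∀ z ∈ M, z ≠ 0 → M.count z = 1

/-- There is a real polynomial `R`, with `e^x R` the composition of `deg R` factors `κ_{a_i}`, such
that the roots of `R` comprise `rneg` negative, `rzero` zero, `rpos` positive and `rcplx` non-real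
ones, the numbers `-a_i` comprise `aneg`, `azero`, `apos` and `acplx` such ones, the non-zero roots
are distinct and the non-zero `a_i` are distinct. -/
def Realizable (rneg rzero rpos rcplx aneg azero apos acplx : ℕ) : Prop :=
  ∃ (R : ℝ[X]) (a : Fin R.natDegree → ℂ),
    R ≠ 0 ∧
    IsSchurSzegoComposition
      (fun x : ℂ => Complex.exp x * (R.map (algebraMap ℝ ℂ)).eval x) (fun i => kappa (a i)) ∧
    HasCounts (R.map (algebraMap ℝ ℂ)).roots rneg rzero rpos rcplx ∧
    HasCounts ((Finset.univ : Finset (Fin R.natDegree)).val.map (fun i => -a i))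
      aneg azero apos acplx

open Filter Topology

/-! The j-th coefficient of `κ_a` is `1 + j/a`, or `j` when `a = 0`. So the composition has
coefficients `P(j)`, where the roots of the polynomial `P` are the numbers `-a_i`, and `R = P(x + x
d/dx) 1` (`hasSum_symbolPoly`). The task becomes to control the roots of `P` and of `R` at once. If
`P = x(x-1)⋯(x-k+1) Q`, then `R = x^k S` with `S = Q(x + k + x d/dx) 1`, so the factor `x^k` of `R`
costs `P` the root 0 and the positive roots `1, …, k-1`.

For `k ≥ 1` and `Q = X^N`, Rolle's theorem gives `S` exactly `N` simple negative roots. Simple roots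
survive perturbation, so some of the zero roots of `Q` can be moved to small positive numbers or
small conjugate pairs while the roots of `S` stay negative (`SmallRoots`). This exchanges positive
or non-real roots of `P` for negative roots of `R`. For `k = 0` the last such move also displaces a
root of `R` from 0; positivity of the coefficients `P(j)` forces it to the left, and this is where a
parity condition enters.

Large roots are then attached to `Q`. A large real root or a large imaginary pair of `Q` produces
roots of the same type in `S`, the old ones being hardly disturbed. Two large positive roots of `Q`
between consecutive integers instead produce a non-real pair in `S`: all coefficients remain
positive, so `R` has no positive root (`add_cplx_pos`). Combining these moves gives all four tables.
-/

/-! ### Locating roots and the persistence of simple roots. -/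

/-- Since `p'/p = ∑ 1/(z - w)` over the roots, roots all at distance at least `ρ` would give `|p'/p|
≤ deg p / ρ`. -/
theorem exists_root_near_of_derivative (p : ℂ[X]) (z : ℂ) {ρ : ℝ}
    (h : p.natDegree * ‖p.eval z‖ < ρ * ‖p.derivative.eval z‖) :
    ∃ w ∈ p.roots, ‖w - z‖ < ρ := by
  have hp : p ≠ 0 := by rintro rfl; simp at h
  have hρ : 0 < ρ := by
    by_contra! hn
    have := mul_nonpos_of_nonpos_of_nonneg hn (norm_nonneg (p.derivative.eval z))
    have : 0 ≤ p.natDegree * ‖p.eval z‖ := by positivity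
    linarith
  by_cases h0 : p.eval z = 0
  · exact ⟨z, (mem_roots hp).2 h0, by simpa using hρ⟩
  by_contra! hc
  have h1 := (IsAlgClosed.splits p).eval_derivative_div_eval_of_ne_zero h0
  have h2 : ‖(p.roots.map fun w ↦ 1 / (z - w)).sum‖ ≤ p.natDegree * (1 / ρ) := by
    refine (norm_multiset_sum_le _).trans ?_
    rw [Multiset.map_map]
    refine (Multiset.sum_le_card_nsmul _ (1 / ρ) ?_).trans ?_
    · intro x hx
      obtain ⟨w, hw, rfl⟩ := Multiset.mem_map.1 hx
      simp only [Function.comp, norm_div, norm_one]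
      rw [norm_sub_rev]
      exact one_div_le_one_div_of_le hρ (hc w hw)
    · rw [Multiset.card_map, nsmul_eq_mul]
      gcongr
      exact p.card_roots'
  rw [← h1, norm_div, div_le_iff₀ (norm_pos_iff.2 h0)] at h2
  have : ρ * ‖p.derivative.eval z‖ ≤ p.natDegree * ‖p.eval z‖ := by
    calc _ ≤ ρ * (p.natDegree * (1 / ρ) * ‖p.eval z‖) := by gcongr
      _ = _ := by field_simp
  linarith

theorem exists_root_near_of_norm_lt (p : ℂ[X]) (z : ℂ) {ρ : ℝ} (hρ : 0 ≤ ρ)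
    (h : ‖p.eval z‖ < ‖p.leadingCoeff‖ * ρ ^ p.natDegree) :
    ∃ w ∈ p.roots, ‖w - z‖ < ρ := by
  by_contra! hc
  have hs := IsAlgClosed.splits p
  rw [hs.eval_eq_prod_roots, norm_mul, hs.natDegree_eq_card_roots] at h
  refine absurd h (not_lt.2 ?_)
  gcongr
  rw [← Multiset.prod_replicate, ← Multiset.map_const', ← normHom_apply (α := ℂ), map_multiset_prod,
    Multiset.map_map]
  refine Multiset.prod_map_le_prod_map₀ _ _ (fun _ _ => hρ) fun w hw => ?_
  simpa [norm_sub_rev] using hc w hw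

theorem conj_mem_aroots {F : ℝ[X]} {z : ℂ} (h : z ∈ F.aroots ℂ) :
    (starRingEnd ℂ) z ∈ F.aroots ℂ := by
  rw [mem_aroots] at h ⊢
  exact ⟨h.1, by rw [aeval_conj, h.2, map_zero]⟩

theorem card_aroots (F : ℝ[X]) : Multiset.card (F.aroots ℂ) = F.natDegree := by
  rw [aroots_def, ← (IsAlgClosed.splits _).natDegree_eq_card_roots, natDegree_map]

theorem eventually_separated (Z : Finset ℂ) {ε : ℝ} (hε : 0 < ε) :
    ∃ ρ, 0 < ρ ∧ ρ ≤ ε ∧ ∀ z ∈ Z, ∀ w ∈ Z, ‖z - w‖ < 2 * ρ → z = w := by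
  have : ∀ᶠ ρ in 𝓝[>] (0 : ℝ), ∀ z ∈ Z, ∀ w ∈ Z, ‖z - w‖ < 2 * ρ → z = w := by
    rw [eventually_all_finset]
    intro z _
    rw [eventually_all_finset]
    intro w _
    by_cases hzw : z = w
    · simp [hzw]
    · have hpos : 0 < ‖z - w‖ / 2 := by
        have := norm_pos_iff.2 (sub_ne_zero.2 hzw)
        positivity
      filter_upwards [Ioo_mem_nhdsGT hpos] with ρ hρ h
      have := hρ.2
      linarith
  obtain ⟨ρ, h1, h2, h3⟩ := (this.and (Ioc_mem_nhdsGT hε)).exists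
  exact ⟨ρ, h2, h3, h1⟩

/-- Each simple root of `S` attracts a root of `F t`. The degree of `F t` may exceed that of `S`;
the set `E` collects roots already known to lie beyond `M`, and the degree bound says that nothing
else is left over. -/
theorem roots_perturb {α : Type*} {l : Filter α} {S : ℝ[X]} {F : α → ℝ[X]} {D : ℕ}
    (hS : (S.aroots ℂ).Nodup) (h0 : S ≠ 0) (hD : ∀ᶠ t in l, (F t).natDegree ≤ D)
    (hF : ∀ z : ℂ, Tendsto (fun t => aeval z (F t)) l (𝓝 (aeval z S)))
    (hF' : ∀ z : ℂ, Tendsto (fun t => aeval z (derivative (F t))) l (𝓝 (aeval z (derivative S))))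
    {ε : ℝ} (hε : 0 < ε) :
    ∃ M : ℝ, ∀ᶠ t in l, ∀ E : Finset ℂ, (∀ w ∈ E, w ∈ (F t).aroots ℂ ∧ M < ‖w‖) →
      (F t).natDegree ≤ S.natDegree + E.card →
      ((F t).aroots ℂ).Nodup ∧ ∃ f : ℂ → ℂ, (F t).aroots ℂ = (S.aroots ℂ).map f + E.val ∧
        ∀ z ∈ S.aroots ℂ, ‖f z - z‖ < ε ∧ ‖f z‖ ≤ M ∧ (z.im = 0 → (f z).im = 0) := by
  classical
  set Z : Finset ℂ := ⟨S.aroots ℂ, hS⟩ with hZ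
  have hZm : ∀ z, z ∈ Z ↔ z ∈ S.aroots ℂ := fun z => Iff.rfl
  obtain ⟨ρ, hρ, hρε, hsep⟩ := eventually_separated Z hε
  obtain ⟨B, hB⟩ := (Z.finite_toSet).isBounded.exists_norm_le
  refine ⟨B + ρ, ?_⟩
  have hnear : ∀ᶠ t in l, ∀ z ∈ Z, ∃ w ∈ (F t).aroots ℂ, ‖w - z‖ < ρ := by
    rw [eventually_all_finset]
    intro z hz
    have hz' := (mem_aroots.1 ((hZm z).1 hz)).2
    have hd : aeval z (derivative S) ≠ 0 := by
      have := (nodup_roots_iff_of_splits (map_ne_zero h0) (IsAlgClosed.splits _)).1 hS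
      rw [separable_map] at this
      exact this.aeval_derivative_ne_zero hz'
    have h1 : Tendsto (fun t => (D : ℝ) * ‖aeval z (F t)‖) l (𝓝 (D * ‖aeval z S‖)) :=
      (hF z).norm.const_mul _
    have h2 : Tendsto (fun t => ρ * ‖aeval z (derivative (F t))‖) l
        (𝓝 (ρ * ‖aeval z (derivative S)‖)) := (hF' z).norm.const_mul _
    have h3 : (D : ℝ) * ‖aeval z S‖ < ρ * ‖aeval z (derivative S)‖ := by
      rw [hz']
      have := norm_pos_iff.2 hd
      simp only [norm_zero, mul_zero]
      positivity
    filter_upwards [h1.eventually_lt h2 h3, hD] with t ht htD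
    refine exists_root_near_of_derivative _ _ ?_
    rw [natDegree_map, derivative_map, eval_map_algebraMap, eval_map_algebraMap]
    refine lt_of_le_of_lt ?_ ht
    gcongr
  have hne : ∀ᶠ t in l, F t ≠ 0 := by
    have : ∃ z : ℂ, aeval z S ≠ 0 := by
      by_contra! hc
      refine map_ne_zero (f := algebraMap ℝ ℂ) h0 (Polynomial.funext fun z => ?_)
      rw [eval_map_algebraMap, hc, eval_zero]
    obtain ⟨z, hz⟩ := this
    filter_upwards [(hF z).eventually_ne hz] with t ht h
    exact ht (by rw [h, map_zero])
  filter_upwards [hnear, hne] with t hnr hFt E hE hdeg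
  choose! f hf hfz using hnr
  have hfM : ∀ z ∈ Z, ‖f z‖ ≤ B + ρ := fun z hz => by
    have := norm_sub_norm_le (f z) z
    have := hfz z hz
    have := hB z hz
    linarith
  have hinj : Set.InjOn f Z := fun z hz w hw h => by
    refine hsep z hz w hw ?_
    have h1 := hfz z hz
    have h2 := hfz w hw
    rw [← h] at h2
    calc ‖z - w‖ = ‖(f z - w) - (f z - z)‖ := by congr 1; ring
      _ ≤ ‖f z - w‖ + ‖f z - z‖ := norm_sub_le _ _
      _ < 2 * ρ := by linarith
  have hdisj : Disjoint (Z.image f) E := by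
    rw [Finset.disjoint_left]
    intro w hw hwE
    obtain ⟨z, hz, rfl⟩ := Finset.mem_image.1 hw
    exact absurd (hfM z hz) (not_le.2 (hE _ hwE).2)
  have hroots : (F t).aroots ℂ = (Z.image f ∪ E).val := by
    refine roots_eq_of_natDegree_le_card_of_ne_zero ?_ ?_ (map_ne_zero hFt)
    · intro w hw
      rw [eval_map_algebraMap]
      rcases Finset.mem_union.1 hw with hw | hw
      · obtain ⟨z, hz, rfl⟩ := Finset.mem_image.1 hw
        exact (mem_aroots.1 (hf z hz)).2
      · exact (mem_aroots.1 (hE w hw).1).2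
    · rw [natDegree_map, Finset.card_union_of_disjoint hdisj, Finset.card_image_of_injOn hinj]
      have : Z.card = S.natDegree := card_aroots S
      omega
  refine ⟨hroots ▸ (Z.image f ∪ E).nodup, f, ?_, ?_⟩
  · rw [hroots, ← Finset.disjUnion_eq_union _ _ hdisj, Finset.disjUnion_val,
      Finset.image_val_of_injOn hinj]
  · intro z hz
    refine ⟨(hfz z hz).trans_le hρε, hfM z hz, fun hzi => ?_⟩
    -- The conjugate of `f z` is a root just as close to the real point `z`. It is too small to lie
    -- in `E`, so by separation it is `f z` itself.
    have hc := conj_mem_aroots (hf z hz)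
    have hzc : (starRingEnd ℂ) z = z := Complex.conj_eq_iff_im.2 hzi
    have hd : ‖(starRingEnd ℂ) (f z) - z‖ < ρ := by
      have h := hfz z hz
      rwa [← Complex.norm_conj, map_sub, hzc] at h
    rw [hroots, Finset.mem_val, Finset.mem_union] at hc
    rcases hc with hc | hc
    · obtain ⟨w, hw, hwe⟩ := Finset.mem_image.1 hc
      have : w = z := by
        refine hsep w hw z hz ?_
        have h2 := hfz w hw
        rw [hwe] at h2
        calc ‖w - z‖ = ‖((starRingEnd ℂ) (f z) - z) - ((starRingEnd ℂ) (f z) - w)‖ := by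
              congr 1; ring
          _ ≤ ‖(starRingEnd ℂ) (f z) - z‖ + ‖(starRingEnd ℂ) (f z) - w‖ := norm_sub_le _ _
          _ < 2 * ρ := by linarith
      rw [this] at hwe
      exact Complex.conj_eq_iff_im.1 hwe.symm
    · have := (hE _ hc).2
      rw [Complex.norm_conj] at this
      exact absurd (hfM z hz) (not_le.2 this)

/-! ### Sign patterns and their stability. -/

open Classical in
/-- The sign pattern recorded by `HasCounts`, without the invariance under conjugation. -/
structure SignCounts (M : Multiset ℂ) (nneg nzero npos ncplx : ℕ) : Prop where
  card_neg : M.countP (fun z => z.im = 0 ∧ z.re < 0) = nneg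
  card_zero : M.count 0 = nzero
  card_pos : M.countP (fun z => z.im = 0 ∧ 0 < z.re) = npos
  card_cplx : M.countP (fun z => z.im ≠ 0) = ncplx
  distinct : ∀ z ∈ M, z ≠ 0 → M.count z = 1

namespace SignCounts

variable {M : Multiset ℂ} {n z p c : ℕ}

theorem hasCounts (h : SignCounts M n z p c) (hc : M.map (starRingEnd ℂ) = M) :
    HasCounts M n z p c :=
  ⟨h.card_neg, h.card_zero, h.card_pos, h.card_cplx, hc, h.distinct⟩

theorem zero : SignCounts 0 0 0 0 0 := ⟨by simp, by simp, by simp, by simp, by simp⟩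

theorem distinct_cons (h : SignCounts M n z p c) {x : ℂ} (hx : x ∉ M) :
    ∀ y ∈ x ::ₘ M, y ≠ 0 → (x ::ₘ M).count y = 1 := by
  intro y hy hy0
  rcases eq_or_ne y x with rfl | hyx
  · rw [Multiset.count_cons_self, Multiset.count_eq_zero_of_notMem hx]
  · rw [Multiset.count_cons_of_ne hyx]
    exact h.distinct y ((Multiset.mem_cons.1 hy).resolve_left hyx) hy0

theorem cons_pos (h : SignCounts M n z p c) {x : ℂ} (hi : x.im = 0) (hr : 0 < x.re)
    (hx : x ∉ M) : SignCounts (x ::ₘ M) n z (p + 1) c := by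
  have hx0 : (0 : ℂ) ≠ x := by rintro rfl; simp at hr
  refine ⟨?_, ?_, ?_, ?_, h.distinct_cons hx⟩
  · rw [Multiset.countP_cons_of_neg _ (by simp [hr.le]), h.card_neg]
  · rw [Multiset.count_cons_of_ne hx0, h.card_zero]
  · rw [Multiset.countP_cons_of_pos _ ⟨hi, hr⟩, h.card_pos]
  · rw [Multiset.countP_cons_of_neg _ (by simp [hi]), h.card_cplx]

theorem cons_neg (h : SignCounts M n z p c) {x : ℂ} (hi : x.im = 0) (hr : x.re < 0)
    (hx : x ∉ M) : SignCounts (x ::ₘ M) (n + 1) z p c := by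
  have hx0 : (0 : ℂ) ≠ x := by rintro rfl; simp at hr
  refine ⟨?_, ?_, ?_, ?_, h.distinct_cons hx⟩
  · rw [Multiset.countP_cons_of_pos _ ⟨hi, hr⟩, h.card_neg]
  · rw [Multiset.count_cons_of_ne hx0, h.card_zero]
  · rw [Multiset.countP_cons_of_neg _ (by simp [hr.le]), h.card_pos]
  · rw [Multiset.countP_cons_of_neg _ (by simp [hi]), h.card_cplx]

theorem cons_cplx (h : SignCounts M n z p c) {x : ℂ} (hi : x.im ≠ 0) (hx : x ∉ M) :
    SignCounts (x ::ₘ M) n z p (c + 1) := by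
  have hx0 : (0 : ℂ) ≠ x := by rintro rfl; simp at hi
  refine ⟨?_, ?_, ?_, ?_, h.distinct_cons hx⟩
  · rw [Multiset.countP_cons_of_neg _ (by simp [hi]), h.card_neg]
  · rw [Multiset.count_cons_of_ne hx0, h.card_zero]
  · rw [Multiset.countP_cons_of_neg _ (by simp [hi]), h.card_pos]
  · rw [Multiset.countP_cons_of_pos (p := fun z : ℂ => z.im ≠ 0) _ hi, h.card_cplx]

theorem cons_zero (h : SignCounts M n z p c) : SignCounts (0 ::ₘ M) n (z + 1) p c := by
  refine ⟨?_, ?_, ?_, ?_, ?_⟩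
  · rw [Multiset.countP_cons_of_neg _ (by simp), h.card_neg]
  · rw [Multiset.count_cons_self, h.card_zero]
  · rw [Multiset.countP_cons_of_neg _ (by simp), h.card_pos]
  · rw [Multiset.countP_cons_of_neg _ (by simp), h.card_cplx]
  · intro y hy hy0
    rw [Multiset.count_cons_of_ne hy0]
    exact h.distinct y ((Multiset.mem_cons.1 hy).resolve_left hy0) hy0

theorem nsmul_zero_add (h : SignCounts M n z p c) (k : ℕ) :
    SignCounts (k • {0} + M) n (z + k) p c := by
  induction k with
  | zero => simpa using h
  | succ k ih =>
    rw [succ_nsmul', add_assoc, Multiset.singleton_add, ← add_assoc]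
    exact ih.cons_zero

theorem card_eq (h : SignCounts M n z p c) : Multiset.card M = n + z + p + c := by
  classical
  have key : ∀ M : Multiset ℂ, Multiset.card M = M.countP (fun z => z.im = 0 ∧ z.re < 0) + M.count 0
      + M.countP (fun z => z.im = 0 ∧ 0 < z.re) + M.countP (fun z => z.im ≠ 0) := by
    intro M
    induction M using Multiset.induction with
    | empty => simp
    | cons x M ih =>
      rw [Multiset.card_cons, ih, Multiset.countP_cons, Multiset.countP_cons, Multiset.countP_cons,
        Multiset.count_cons]
      by_cases hi : x.im = 0
      · rcases lt_trichotomy x.re 0 with hr | hr | hr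
        · have hx0 : (0 : ℂ) ≠ x := by rintro rfl; simp at hr
          simp [hi, hr, hx0, not_lt.2 hr.le]
          ring
        · have hx0 : x = 0 := Complex.ext hr hi
          simp [hx0]
          ring
        · have hx0 : (0 : ℂ) ≠ x := by rintro rfl; simp at hr
          simp [hi, hr, hx0, not_lt.2 hr.le]
          ring
      · have hx0 : (0 : ℂ) ≠ x := by rintro rfl; simp at hi
        simp [hi, hx0]
        ring
  rw [key, ← h.card_neg, ← h.card_zero, ← h.card_pos, ← h.card_cplx]

theorem zero_notMem (h : SignCounts M n 0 p c) : (0 : ℂ) ∉ M := by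
  classical
  have := h.card_zero
  intro h0
  have h1 := Multiset.one_le_count_iff_mem.2 h0
  omega

theorem nodup (h : SignCounts M n 0 p c) : M.Nodup := by
  classical
  rw [Multiset.nodup_iff_count_eq_one]
  intro y hy
  have := h.distinct y hy (fun h0 => h.zero_notMem (h0 ▸ hy))
  rw [← this]

/-- Choose `ε` below every non-zero `|im|` and below `|re|` of every real member: non-real members
cannot reach the real axis and real ones cannot cross 0. -/
theorem map_of_near (h : SignCounts M n 0 p c) : ∃ ε, 0 < ε ∧ ∀ f : ℂ → ℂ,
    (∀ w ∈ M, ‖f w - w‖ < ε ∧ (w.im = 0 → (f w).im = 0)) → (M.map f).Nodup →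
    SignCounts (M.map f) n 0 p c := by
  classical
  have h1 : ∀ᶠ ε in 𝓝[>] (0 : ℝ), ∀ w ∈ M.toFinset,
      (w.im ≠ 0 → ε < |w.im|) ∧ (w.im = 0 → ε < |w.re|) := by
    rw [eventually_all_finset]
    intro w hw
    by_cases hi : w.im = 0
    · have hr : w.re ≠ 0 := fun hr => h.zero_notMem (by
        have : w = 0 := Complex.ext hr hi
        rw [← this]; exact Multiset.mem_toFinset.1 hw)
      filter_upwards [Ioo_mem_nhdsGT (abs_pos.2 hr)] with ε hε
      exact ⟨fun h => absurd hi h, fun _ => hε.2⟩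
    · filter_upwards [Ioo_mem_nhdsGT (abs_pos.2 hi)] with ε hε
      exact ⟨fun _ => hε.2, fun h => absurd h hi⟩
  obtain ⟨ε, hε, hpos⟩ := (h1.and self_mem_nhdsWithin).exists
  refine ⟨ε, hpos, fun f hf hnd => ?_⟩
  have him : ∀ w ∈ M, ((f w).im = 0 ↔ w.im = 0) := fun w hw => by
    refine ⟨fun h2 => ?_, (hf w hw).2⟩
    by_contra hi
    have h3 := (hε w (Multiset.mem_toFinset.2 hw)).1 hi
    have h4 := Complex.abs_im_le_norm (f w - w)
    rw [Complex.sub_im, h2, zero_sub, abs_neg] at h4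
    linarith [(hf w hw).1]
  have hre : ∀ w ∈ M, w.im = 0 → (((f w).re < 0 ↔ w.re < 0) ∧ (0 < (f w).re ↔ 0 < w.re)) := by
    intro w hw hi
    have h3 := (hε w (Multiset.mem_toFinset.2 hw)).2 hi
    have h4 := (Complex.abs_re_le_norm (f w - w)).trans_lt (hf w hw).1
    rw [Complex.sub_re, abs_lt] at h4
    rcases lt_abs.1 h3 with h5 | h5
    · constructor <;> constructor <;> intro <;> linarith
    · constructor <;> constructor <;> intro <;> linarith
  have hcong : ∀ q r : ℂ → Prop, ∀ [DecidablePred q] [DecidablePred r], (∀ w ∈ M, q (f w) ↔ r w) →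
      (M.map f).countP q = M.countP r := by
    intro q r _ _ hqr
    rw [Multiset.countP_map, Multiset.countP_eq_card_filter]
    congr 1
    exact Multiset.filter_congr hqr
  refine ⟨?_, ?_, ?_, ?_, ?_⟩
  · rw [← h.card_neg]
    refine hcong _ _ fun w hw => ?_
    rw [him w hw]
    exact and_congr_right fun hi => (hre w hw hi).1
  · rw [Multiset.count_eq_zero]
    intro h0
    obtain ⟨w, hw, hw0⟩ := Multiset.mem_map.1 h0
    have hi : w.im = 0 := (him w hw).1 (by simp [hw0])
    have h2 := hre w hw hi
    rw [hw0] at h2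
    simp only [Complex.zero_re, lt_irrefl, false_iff, not_lt] at h2
    have : w = 0 := Complex.ext (le_antisymm h2.2 h2.1) hi
    exact h.zero_notMem (this ▸ hw)
  · rw [← h.card_pos]
    refine hcong _ _ fun w hw => ?_
    rw [him w hw]
    exact and_congr_right fun hi => (hre w hw hi).2
  · rw [← h.card_cplx]
    refine hcong _ _ fun w hw => ?_
    rw [not_iff_not, him w hw]
  · intro w hw _
    have := (Multiset.nodup_iff_count_eq_one.1 hnd) w hw
    rw [← this]

end SignCounts

/-! ### Sign patterns of perturbed polynomials, with roots coming from infinity. -/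

/-- `F t` tends to `S`, in values and derivatives, through polynomials of bounded degree. -/
structure PolyTendsto {α : Type*} (F : α → ℝ[X]) (l : Filter α) (S : ℝ[X]) : Prop where
  degree_le : ∃ D, ∀ᶠ t in l, (F t).natDegree ≤ D
  eval : ∀ z : ℂ, Tendsto (fun t => aeval z (F t)) l (𝓝 (aeval z S))
  eval_derivative : ∀ z : ℂ,
    Tendsto (fun t => aeval z (derivative (F t))) l (𝓝 (aeval z (derivative S)))

theorem PolyTendsto.add_smul_add_smul {α : Type*} {l : Filter α} {u v : α → ℝ}
    (hu : Tendsto u l (𝓝 0)) (hv : Tendsto v l (𝓝 0)) (S G H : ℝ[X]) :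
    PolyTendsto (fun t => S + u t • G + v t • H) l S := by
  have key : ∀ (S G H : ℝ[X]) (z : ℂ),
      Tendsto (fun t => aeval z (S + u t • G + v t • H)) l (𝓝 (aeval z S)) := by
    intro S G H z
    have h1 : Tendsto (fun t => aeval z S + (u t : ℂ) * aeval z G + (v t : ℂ) * aeval z H) l
        (𝓝 (aeval z S + ((0 : ℝ) : ℂ) * aeval z G + ((0 : ℝ) : ℂ) * aeval z H)) := by
      have hu' := (Complex.continuous_ofReal.tendsto 0).comp hu
      have hv' := (Complex.continuous_ofReal.tendsto 0).comp hv
      exact (tendsto_const_nhds.add (hu'.mul_const _)).add (hv'.mul_const _)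
    simpa using h1
  refine ⟨⟨max (max S.natDegree G.natDegree) H.natDegree, Eventually.of_forall fun t => ?_⟩,
    key S G H, fun z => ?_⟩
  · refine natDegree_add_le_of_le (natDegree_add_le_of_le le_rfl ?_) ?_ <;>
    exact natDegree_smul_le _ _
  · simpa only [derivative_add, derivative_smul] using
      key (derivative S) (derivative G) (derivative H) z

section

variable {α : Type*} {l : Filter α} {S : ℝ[X]} {F : α → ℝ[X]} {n p c : ℕ}

theorem SignCounts.perturb (hF : PolyTendsto F l S) (h0 : S ≠ 0)
    (h : SignCounts (S.aroots ℂ) n 0 p c) :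
    ∃ M : ℝ, ∀ᶠ t in l, ∀ E : Finset ℂ, (∀ w ∈ E, w ∈ (F t).aroots ℂ ∧ M < ‖w‖) →
      (F t).natDegree ≤ S.natDegree + E.card →
      ∃ A, SignCounts A n 0 p c ∧ (F t).aroots ℂ = A + E.val ∧ ((F t).aroots ℂ).Nodup ∧
        ∀ z ∈ A, ‖z‖ ≤ M := by
  obtain ⟨ε, hε, hmap⟩ := h.map_of_near
  obtain ⟨D, hD⟩ := hF.degree_le
  obtain ⟨M, hM⟩ := roots_perturb h.nodup h0 hD hF.eval hF.eval_derivative hε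
  refine ⟨M, ?_⟩
  filter_upwards [hM] with t ht E hE hdeg
  obtain ⟨hnd, f, hroots, hf⟩ := ht E hE hdeg
  refine ⟨_, hmap f (fun w hw => ⟨(hf w hw).1, (hf w hw).2.2⟩) ?_, hroots, hnd, ?_⟩
  · rw [hroots] at hnd
    exact (Multiset.nodup_add.1 hnd).1
  · intro w hw
    obtain ⟨z, hz, rfl⟩ := Multiset.mem_map.1 hw
    exact (hf z hz).2.1

theorem SignCounts.perturb_same (hF : PolyTendsto F l S) (h0 : S ≠ 0)
    (h : SignCounts (S.aroots ℂ) n 0 p c) (hdeg : ∀ᶠ t in l, (F t).natDegree ≤ S.natDegree) :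
    ∀ᶠ t in l, SignCounts ((F t).aroots ℂ) n 0 p c := by
  obtain ⟨M, hM⟩ := h.perturb hF h0
  filter_upwards [hM, hdeg] with t ht hd
  obtain ⟨A, hA, hroots, -⟩ := ht ∅ (by simp) (by simpa using hd)
  rw [hroots]
  simpa using hA

/-- There is room for only one root beyond `M`, and its conjugate is another such root, so it is
real. -/
theorem SignCounts.perturb_real (hF : PolyTendsto F l S) (h0 : S ≠ 0)
    (h : SignCounts (S.aroots ℂ) n 0 p c) (hdeg : ∀ᶠ t in l, (F t).natDegree ≤ S.natDegree + 1)
    {q : ℂ → Prop} (hq : ∀ M : ℝ, ∀ᶠ t in l, ∃ w ∈ (F t).aroots ℂ, M < ‖w‖ ∧ q w) :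
    ∀ᶠ t in l, ∃ A, SignCounts A n 0 p c ∧ ∃ w, (F t).aroots ℂ = w ::ₘ A ∧ w ∉ A ∧ w.im = 0 ∧
      q w := by
  obtain ⟨M, hM⟩ := h.perturb hF h0
  filter_upwards [hM, hdeg, hq M] with t ht hd ⟨w, hw, hwM, hqw⟩
  obtain ⟨A, hA, hroots, hnd, hAM⟩ := ht {w} (by simpa using ⟨mem_aroots.1 hw, hwM⟩) (by simpa using hd)
  rw [Finset.singleton_val, add_comm, Multiset.singleton_add] at hroots
  refine ⟨A, hA, w, hroots, fun hwA => absurd (hAM w hwA) (not_le.2 hwM), ?_, hqw⟩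
  have hc := conj_mem_aroots hw
  rw [hroots, Multiset.mem_cons] at hc
  rcases hc with hc | hc
  · exact Complex.conj_eq_iff_im.1 hc
  · have := hAM _ hc
    rw [Complex.norm_conj] at this
    exact absurd this (not_le.2 hwM)

theorem SignCounts.perturb_pos (hF : PolyTendsto F l S) (h0 : S ≠ 0)
    (h : SignCounts (S.aroots ℂ) n 0 p c) (hdeg : ∀ᶠ t in l, (F t).natDegree ≤ S.natDegree + 1)
    (hq : ∀ M : ℝ, ∀ᶠ t in l, ∃ w ∈ (F t).aroots ℂ, M < ‖w‖ ∧ 0 < w.re) :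
    ∀ᶠ t in l, SignCounts ((F t).aroots ℂ) n 0 (p + 1) c := by
  filter_upwards [h.perturb_real hF h0 hdeg hq] with t ⟨A, hA, w, hr, hwA, hi, hre⟩
  rw [hr]
  exact hA.cons_pos hi hre hwA

theorem SignCounts.perturb_neg (hF : PolyTendsto F l S) (h0 : S ≠ 0)
    (h : SignCounts (S.aroots ℂ) n 0 p c) (hdeg : ∀ᶠ t in l, (F t).natDegree ≤ S.natDegree + 1)
    (hq : ∀ M : ℝ, ∀ᶠ t in l, ∃ w ∈ (F t).aroots ℂ, M < ‖w‖ ∧ w.re < 0) :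
    ∀ᶠ t in l, SignCounts ((F t).aroots ℂ) (n + 1) 0 p c := by
  filter_upwards [h.perturb_real hF h0 hdeg hq] with t ⟨A, hA, w, hr, hwA, hi, hre⟩
  rw [hr]
  exact hA.cons_neg hi hre hwA

/-- One large non-real root is enough: its conjugate fills the second and last free place. -/
theorem SignCounts.perturb_cplx (hF : PolyTendsto F l S) (h0 : S ≠ 0)
    (h : SignCounts (S.aroots ℂ) n 0 p c) (hdeg : ∀ᶠ t in l, (F t).natDegree ≤ S.natDegree + 2)
    (hq : ∀ M : ℝ, ∀ᶠ t in l, ∃ w ∈ (F t).aroots ℂ, M < ‖w‖ ∧ w.im ≠ 0) :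
    ∀ᶠ t in l, SignCounts ((F t).aroots ℂ) n 0 p (c + 2) := by
  obtain ⟨M, hM⟩ := h.perturb hF h0
  filter_upwards [hM, hdeg, hq M] with t ht hd ⟨w, hw, hwM, hi⟩
  have hne : w ≠ (starRingEnd ℂ) w := fun h => hi (Complex.conj_eq_iff_im.1 h.symm)
  obtain ⟨A, hA, hroots, hnd, hAM⟩ := ht {w, (starRingEnd ℂ) w} (by
    intro x hx
    rcases Finset.mem_insert.1 hx with rfl | hx
    · exact ⟨hw, hwM⟩
    · rw [Finset.mem_singleton.1 hx, Complex.norm_conj]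
      exact ⟨conj_mem_aroots hw, hwM⟩) (by rw [Finset.card_pair hne]; exact hd)
  have hv : ({w, (starRingEnd ℂ) w} : Finset ℂ).val = w ::ₘ {(starRingEnd ℂ) w} := by
    rw [Finset.insert_val_of_notMem (by simpa using hne), Finset.singleton_val]
  rw [hv, add_comm, Multiset.cons_add, Multiset.singleton_add] at hroots
  rw [hroots]
  rw [hroots, Multiset.nodup_cons, Multiset.nodup_cons] at hnd
  exact (hA.cons_cplx (by simpa using hi) hnd.2.1).cons_cplx hi hnd.1

end

/-! ### From the symbol `Q` to the polynomial factor of the exponential series. -/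

/-- The operator `F ↦ x^{1-k} e^{-x} (x^k e^x F)'`. -/
noncomputable def eulerOp (k : ℕ) : Module.End ℝ ℝ[X] :=
  LinearMap.mulLeft ℝ (X + C (k : ℝ)) + LinearMap.mulLeft ℝ X ∘ₗ derivative

theorem eulerOp_apply (k : ℕ) (F : ℝ[X]) :
    eulerOp k F = (X + C (k : ℝ)) * F + X * derivative F := rfl

/-- The polynomial `S` with `∑ Q(j + k) x^j / j! = e^x S`. -/
noncomputable def symbolPoly (k : ℕ) (Q : ℝ[X]) : ℝ[X] := aeval (eulerOp k) Q 1

theorem symbolPoly_mul (k : ℕ) (P Q : ℝ[X]) :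
    symbolPoly k (P * Q) = aeval (eulerOp k) P (symbolPoly k Q) := by
  simp [symbolPoly]

theorem symbolPoly_add (k : ℕ) (P Q : ℝ[X]) :
    symbolPoly k (P + Q) = symbolPoly k P + symbolPoly k Q := by
  simp [symbolPoly]

theorem symbolPoly_smul (k : ℕ) (a : ℝ) (Q : ℝ[X]) :
    symbolPoly k (a • Q) = a • symbolPoly k Q := by
  simp [symbolPoly]

theorem symbolPoly_one (k : ℕ) : symbolPoly k 1 = 1 := by simp [symbolPoly]

theorem symbolPoly_X_mul (k : ℕ) (Q : ℝ[X]) :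
    symbolPoly k (X * Q) = eulerOp k (symbolPoly k Q) := by
  rw [symbolPoly_mul, aeval_X]

/-- Commuting `x d/dx` past `x^k` adds `k`; this is how a factor `x^k` of `R` shifts the operator.
-/
theorem eulerOp_zero_X_pow_mul (k : ℕ) (F : ℝ[X]) :
    eulerOp 0 (X ^ k * F) = X ^ k * eulerOp k F := by
  rw [eulerOp_apply, eulerOp_apply]
  cases k with
  | zero => simp
  | succ k =>
    simp only [derivative_mul, derivative_X_pow, Nat.add_sub_cancel]
    simp
    ring

theorem aeval_eulerOp_zero_X_pow_mul (k : ℕ) (Q F : ℝ[X]) :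
    aeval (eulerOp 0) Q (X ^ k * F) = X ^ k * aeval (eulerOp k) Q F := by
  induction Q using Polynomial.induction_on generalizing F with
  | C a => simp [aeval_C]
  | add P Q hP hQ => simp [hP, hQ, mul_add]
  | monomial n a ih =>
    have h : (C a * X ^ (n + 1) : ℝ[X]) = (C a * X ^ n) * X := by ring
    rw [h, map_mul _ (C a * X ^ n) X, Module.End.mul_apply, aeval_X, eulerOp_zero_X_pow_mul, ih,
      map_mul _ (C a * X ^ n) X, Module.End.mul_apply, aeval_X]

theorem symbolPoly_zero_descPochhammer (k : ℕ) : symbolPoly 0 (descPochhammer ℝ k) = X ^ k := by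
  induction k with
  | zero => simp [symbolPoly_one]
  | succ k ih =>
    rw [descPochhammer_succ_right, mul_comm, symbolPoly_mul, ih]
    have h1 : eulerOp 0 (X ^ k) = X ^ (k + 1) + (k : ℝ) • X ^ k := by
      rw [← mul_one (X ^ k : ℝ[X]), eulerOp_zero_X_pow_mul, eulerOp_apply, smul_eq_C_mul]
      simp
      ring
    have h2 : ((k : ℕ) : ℝ[X]) = C (k : ℝ) := by simp
    rw [map_sub, aeval_X, h2, aeval_C, LinearMap.sub_apply, h1]
    simp [smul_eq_C_mul]

theorem symbolPoly_zero_descPochhammer_mul (k : ℕ) (Q : ℝ[X]) :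
    symbolPoly 0 (descPochhammer ℝ k * Q) = X ^ k * symbolPoly k Q := by
  rw [mul_comm, symbolPoly_mul, symbolPoly_zero_descPochhammer, ← mul_one (X ^ k : ℝ[X]),
    aeval_eulerOp_zero_X_pow_mul, mul_one, symbolPoly]

/-- Reduces the linear identity `hasSum_symbolPoly` to falling factorials, for which the series is a
shifted exponential. -/
theorem mem_span_descPochhammer (P : ℝ[X]) :
    P ∈ Submodule.span ℝ (Set.range (descPochhammer ℝ)) := by
  have hX : ∀ Q ∈ Submodule.span ℝ (Set.range (descPochhammer ℝ)),
      Q * X ∈ Submodule.span ℝ (Set.range (descPochhammer ℝ)) := by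
    intro Q hQ
    induction hQ using Submodule.span_induction with
    | mem Q hQ =>
      obtain ⟨n, rfl⟩ := hQ
      have : descPochhammer ℝ n * X = descPochhammer ℝ (n + 1) + (n : ℝ) • descPochhammer ℝ n := by
        rw [descPochhammer_succ_right, smul_eq_C_mul]
        simp
        ring
      rw [this]
      exact add_mem (Submodule.subset_span ⟨_, rfl⟩)
        (Submodule.smul_mem _ _ (Submodule.subset_span ⟨_, rfl⟩))
    | zero => simp
    | add P Q _ _ hP hQ => rw [add_mul]; exact add_mem hP hQ
    | smul a Q _ hQ => rw [smul_mul_assoc]; exact Submodule.smul_mem _ _ hQ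
  induction P using Polynomial.induction_on with
  | C a =>
    rw [← mul_one (C a), ← smul_eq_C_mul]
    exact Submodule.smul_mem _ _ (Submodule.subset_span ⟨0, by simp⟩)
  | add P Q hP hQ => exact add_mem hP hQ
  | monomial n a ih =>
    rw [pow_succ, ← mul_assoc]
    exact hX _ ih

theorem HasSum.of_eq {f g : ℕ → ℂ} {a : ℂ} (h : HasSum g a) (e : ∀ j, f j = g j) : HasSum f a := by
  rwa [funext e]

theorem hasSum_symbolPoly (P : ℝ[X]) (x : ℂ) :
    HasSum (fun j : ℕ => ((P.eval (j : ℝ) : ℝ) : ℂ) * x ^ j / (Nat.factorial j : ℂ))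
      (Complex.exp x * aeval x (symbolPoly 0 P)) := by
  induction mem_span_descPochhammer P using Submodule.span_induction with
  | mem Q hQ =>
    obtain ⟨n, rfl⟩ := hQ
    rw [symbolPoly_zero_descPochhammer, map_pow, aeval_X, mul_comm]
    have hexp : HasSum (fun j : ℕ => x ^ j / (Nat.factorial j : ℂ)) (Complex.exp x) := by
      rw [Complex.exp_eq_exp_ℂ]
      exact NormedSpace.expSeries_div_hasSum_exp x
    rw [← hasSum_nat_add_iff' n, Finset.sum_eq_zero, sub_zero]
    · refine HasSum.of_eq (hexp.mul_left (x ^ n)) fun j => ?_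
      have h := Nat.factorial_mul_descFactorial (Nat.le_add_left n j)
      rw [Nat.add_sub_cancel] at h
      have h' : ((Nat.factorial (j + n) : ℕ) : ℂ) =
          (Nat.factorial j : ℂ) * (Nat.descFactorial (j + n) n : ℂ) := by
        rw [← h]; push_cast; ring
      have h1 : (Nat.factorial j : ℂ) ≠ 0 := by exact_mod_cast Nat.factorial_ne_zero j
      have h2 : (Nat.descFactorial (j + n) n : ℂ) ≠ 0 := by
        have := Nat.factorial_ne_zero (j + n)
        rw [← h] at this
        exact_mod_cast right_ne_zero_of_mul this
      rw [descPochhammer_eval_eq_descFactorial, h', Complex.ofReal_natCast]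
      field_simp
      ring
    · intro j hj
      rw [descPochhammer_eval_coe_nat_of_lt (Finset.mem_range.1 hj)]
      simp
  | zero =>
    simp [symbolPoly]
  | add P Q _ _ hP hQ =>
    rw [symbolPoly_add, map_add, mul_add]
    refine HasSum.of_eq (hP.add hQ) fun j => ?_
    rw [eval_add]
    push_cast
    ring
  | smul a Q _ hQ =>
    have h : Complex.exp x * aeval x (symbolPoly 0 (a • Q)) =
        a * (Complex.exp x * aeval x (symbolPoly 0 Q)) := by
      rw [symbolPoly_smul, map_smul, Complex.real_smul]
      ring
    rw [h]
    refine HasSum.of_eq (hQ.mul_left (a : ℂ)) fun j => ?_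
    rw [eval_smul, smul_eq_mul]
    push_cast
    ring

/-- In the series of `e^x x^k symbolPoly k Q` the terms with `j < k` vanish, the later ones are
non-negative and the one with `j = k` is positive. Assuming `0 < x ^ k` admits `x = 0` exactly when
`k = 0`. -/
theorem symbolPoly_eval_pos (k : ℕ) {Q : ℝ[X]} (hQ : ∀ j : ℕ, 0 < Q.eval ((j : ℝ) + k)) {x : ℝ}
    (hx : 0 ≤ x) (hxk : 0 < x ^ k) : 0 < (symbolPoly k Q).eval x := by
  have h := hasSum_symbolPoly (descPochhammer ℝ k * Q) (x : ℂ)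
  rw [symbolPoly_zero_descPochhammer_mul] at h
  have h2 : HasSum (fun j : ℕ => (descPochhammer ℝ k * Q).eval (j : ℝ) * x ^ j / (Nat.factorial j : ℝ))
      (Real.exp x * (X ^ k * symbolPoly k Q).eval x) := by
    rw [← Complex.hasSum_ofReal]
    convert h using 2 with j
    · push_cast; rfl
    · rw [← Complex.coe_algebraMap, aeval_algebraMap_apply_eq_algebraMap_eval]
      simp
  have hval : ∀ j : ℕ, k ≤ j → 0 < (descPochhammer ℝ k * Q).eval (j : ℝ) := by
    intro j hj
    rw [eval_mul]
    refine mul_pos (descPochhammer_pos ?_) ?_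
    · have : (k : ℝ) ≤ j := by exact_mod_cast hj
      linarith
    · have := hQ (j - k)
      rwa [Nat.cast_sub hj, sub_add_cancel] at this
  have h3 : 0 < Real.exp x * (X ^ k * symbolPoly k Q).eval x := by
    refine lt_of_lt_of_le ?_ (sum_le_hasSum {k} (fun j _ => ?_) h2)
    · rw [Finset.sum_singleton]
      have := hval k le_rfl
      positivity
    · rcases lt_or_ge j k with hj | hj
      · rw [eval_mul, descPochhammer_eval_coe_nat_of_lt hj]
        simp
      · have := hval j hj
        positivity
  rw [eval_mul, eval_pow, eval_X] at h3
  have h4 := pos_of_mul_pos_right h3 (Real.exp_pos x).le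
  exact pos_of_mul_pos_right h4 hxk.le

/-! ### Degrees, and negative roots by Rolle's theorem. -/

theorem natDegree_eulerOp_le (k : ℕ) (F : ℝ[X]) : (eulerOp k F).natDegree ≤ F.natDegree + 1 := by
  rw [eulerOp_apply]
  refine (natDegree_add_le _ _).trans (max_le ?_ ?_)
  · refine (natDegree_mul_le (p := X + C (k : ℝ)) (q := F)).trans ?_
    rw [natDegree_X_add_C, add_comm]
  · refine (natDegree_mul_le (p := X) (q := derivative F)).trans ?_
    have := natDegree_derivative_le F
    rw [natDegree_X]
    omega

theorem coeff_eulerOp (k : ℕ) {F : ℝ[X]} {n : ℕ} (h : F.natDegree ≤ n) :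
    (eulerOp k F).coeff (n + 1) = F.coeff n := by
  have h1 : F.coeff (n + 1) = 0 := coeff_eq_zero_of_natDegree_lt (by omega)
  rw [eulerOp_apply, add_mul, coeff_add, coeff_add, coeff_X_mul, coeff_C_mul, coeff_X_mul,
    coeff_derivative, h1]
  simp

theorem natDegree_eulerOp (k : ℕ) {F : ℝ[X]} (hF : F ≠ 0) :
    (eulerOp k F).natDegree = F.natDegree + 1 := by
  refine le_antisymm (natDegree_eulerOp_le k F) (le_natDegree_of_ne_zero ?_)
  rw [coeff_eulerOp k le_rfl]
  exact leadingCoeff_ne_zero.2 hF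

theorem eulerOp_ne_zero (k : ℕ) {F : ℝ[X]} (hF : F ≠ 0) : eulerOp k F ≠ 0 := by
  intro h
  have := natDegree_eulerOp k hF
  rw [h] at this
  simp at this

/-- The function `x^(m+1) e^x F` vanishes on `s`, at 0 and at `-∞`, so Rolle's theorem gives one
more critical point than `s` has elements. -/
theorem exists_roots_eulerOp (m : ℕ) {F : ℝ[X]} (hF : F ≠ 0) (s : Finset ℝ)
    (hs : ∀ x ∈ s, x < 0 ∧ F.eval x = 0) :
    ∃ t : Finset ℝ, s.card + 1 ≤ t.card ∧ ∀ x ∈ t, x < 0 ∧ (eulerOp (m + 1) F).eval x = 0 := by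
  classical
  set φ : ℝ → ℝ := fun x => x ^ (m + 1) * Real.exp x * F.eval x with hφ
  have hd : ∀ x, HasDerivAt φ (x ^ m * Real.exp x * (eulerOp (m + 1) F).eval x) x := by
    intro x
    have h1 := ((hasDerivAt_pow (m + 1) x).mul (Real.hasDerivAt_exp x)).mul (F.hasDerivAt x)
    refine HasDerivAt.congr_deriv (f := φ) h1 ?_
    rw [eulerOp_apply]
    simp
    ring
  have hcont : Continuous φ := continuous_iff_continuousAt.2 fun x => (hd x).continuousAt
  have hcrit : ∀ x < 0, x ^ m * Real.exp x * (eulerOp (m + 1) F).eval x = 0 →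
      (eulerOp (m + 1) F).eval x = 0 := by
    intro x hx h
    exact (mul_eq_zero.1 h).resolve_left (mul_ne_zero (pow_ne_zero _ hx.ne) (Real.exp_ne_zero x))
  set s0 : Finset ℝ := insert 0 s with hs0
  have hz : ∀ x ∈ s0, x ≤ 0 ∧ φ x = 0 := by
    intro x hx
    rcases Finset.mem_insert.1 hx with rfl | hx
    · simp [hφ]
    · exact ⟨(hs x hx).1.le, by simp [hφ, (hs x hx).2]⟩
  have hne : s0.Nonempty := ⟨0, Finset.mem_insert_self _ _⟩
  set x₁ := s0.min' hne with hx₁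
  have hx₁s : x₁ ∈ s0 := Finset.min'_mem _ _
  -- Rolle on `(-∞, x₁)`: with `φ y ≠ 0` and `b` so far left that `|φ b| < |φ y|`, the maximum of
  -- `φ²` on `[b, x₁]` is interior.
  obtain ⟨y, hy, hyF⟩ := (Set.Iio_infinite x₁).exists_notMem_finset F.roots.toFinset
  have hy0 : y < 0 := lt_of_lt_of_le hy (hz _ hx₁s).1
  have hyφ : φ y ≠ 0 := by
    rw [Multiset.mem_toFinset, mem_roots hF] at hyF
    exact mul_ne_zero (mul_ne_zero (pow_ne_zero _ hy0.ne) (Real.exp_ne_zero _)) hyF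
  have hlim : Tendsto φ atBot (𝓝 0) := by
    have h1 := (Polynomial.tendsto_div_exp_atTop ((X ^ (m + 1) * F).comp (-X))).comp
      tendsto_neg_atBot_atTop
    refine h1.congr fun x => ?_
    simp [hφ, Real.exp_neg]
    ring
  obtain ⟨b, hb, hby⟩ := ((hlim.abs.eventually_lt_const (by simpa using hyφ)).and
    (eventually_lt_atBot y)).exists (p := fun b => |φ b| < |φ y| ∧ b < y)
  have hbx : b < x₁ := hby.trans hy
  obtain ⟨c, hc, hcmax⟩ := (isCompact_Icc (a := b) (b := x₁)).exists_isMaxOn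
    (Set.nonempty_Icc.2 hbx.le) ((hcont.pow 2).continuousOn)
  have hcy : φ y ^ 2 ≤ φ c ^ 2 := hcmax ⟨hby.le, (Set.mem_Iio.1 hy).le⟩
  have hc0 : φ c ≠ 0 := by
    intro h
    rw [h] at hcy
    have : 0 < φ y ^ 2 := by positivity
    simp at hcy
    exact hyφ hcy
  have hcb : c ≠ b := by
    rintro rfl
    exact absurd (sq_le_sq.1 hcy) (not_le.2 hb)
  have hcx : c ≠ x₁ := by
    intro h
    exact hc0 (h ▸ (hz _ hx₁s).2)
  have hcI : c ∈ Set.Ioo b x₁ := ⟨lt_of_le_of_ne hc.1 hcb.symm, lt_of_le_of_ne hc.2 hcx⟩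
  have hc_neg : c < 0 := hcI.2.trans_le (hz _ hx₁s).1
  have hcroot : (eulerOp (m + 1) F).eval c = 0 := by
    have h1 := (hcmax.isLocalMax (Icc_mem_nhds hcI.1 hcI.2)).hasDerivAt_eq_zero ((hd c).pow 2)
    refine hcrit c hc_neg ((mul_eq_zero.1 h1).resolve_left ?_)
    simpa using hc0
  set t : Finset ℝ := (eulerOp (m + 1) F).roots.toFinset.filter (· < 0) with ht
  have hmem : ∀ x, x < 0 → (eulerOp (m + 1) F).eval x = 0 → x ∈ t := by
    intro x hx h
    rw [ht, Finset.mem_filter, Multiset.mem_toFinset, mem_roots (eulerOp_ne_zero _ hF)]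
    exact ⟨h, hx⟩
  refine ⟨t, ?_, fun x hx => ?_⟩
  · have hbs : b ∉ s0 := fun h => absurd (Finset.min'_le _ _ h) (not_le.2 hbx)
    have h0s : (0 : ℝ) ∉ s := fun h => absurd (hs 0 h).1 (lt_irrefl _)
    -- Adding `b` to the nodes accounts for the critical point `c`: `s.card + 2` nodes are separated
    -- by elements of `t`.
    have := Finset.card_le_of_interleaved (s := insert b s0) (t := t) (by
      intro x hx y hy hxy _
      have hy' : y ∈ s0 := by
        rcases Finset.mem_insert.1 hy with rfl | hy
        · rcases Finset.mem_insert.1 hx with rfl | hx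
          · exact absurd hxy (lt_irrefl _)
          · exact absurd (hbx.trans_le (Finset.min'_le _ _ hx)) (not_lt.2 hxy.le)
        · exact hy
      rcases Finset.mem_insert.1 hx with rfl | hx
      · exact ⟨c, hmem c hc_neg hcroot, hcI.1, hcI.2.trans_le (Finset.min'_le _ _ hy')⟩
      · obtain ⟨z, hzI, hz0⟩ := exists_hasDerivAt_eq_zero hxy hcont.continuousOn
          ((hz x hx).2.trans (hz y hy').2.symm) (fun z _ => hd z)
        have hzn : z < 0 := hzI.2.trans_le (hz y hy').1
        exact ⟨z, hmem z hzn (hcrit z hzn hz0), hzI.1, hzI.2⟩)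
    rw [Finset.card_insert_of_notMem hbs, hs0, Finset.card_insert_of_notMem h0s] at this
    omega
  · rw [ht, Finset.mem_filter, Multiset.mem_toFinset, mem_roots (eulerOp_ne_zero _ hF)] at hx
    exact ⟨hx.2, hx.1⟩

theorem symbolPoly_X_pow (m N : ℕ) : symbolPoly (m + 1) (X ^ N) ≠ 0 ∧
    (symbolPoly (m + 1) (X ^ N)).natDegree = N ∧
    ∃ s : Finset ℝ, N ≤ s.card ∧ ∀ x ∈ s, x < 0 ∧ (symbolPoly (m + 1) (X ^ N)).eval x = 0 := by
  induction N with
  | zero => exact ⟨by simp [symbolPoly_one], by simp [symbolPoly_one], ∅, by simp⟩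
  | succ N ih =>
    obtain ⟨h0, hd, s, hs, hsr⟩ := ih
    rw [pow_succ', symbolPoly_X_mul]
    obtain ⟨t, ht, htr⟩ := exists_roots_eulerOp m h0 s hsr
    exact ⟨eulerOp_ne_zero _ h0, by rw [natDegree_eulerOp _ h0, hd], t, by omega, htr⟩

theorem SignCounts.of_forall_neg {M : Multiset ℂ} (hnd : M.Nodup)
    (h : ∀ z ∈ M, z.im = 0 ∧ z.re < 0) : SignCounts M (Multiset.card M) 0 0 0 := by
  induction M using Multiset.induction with
  | empty => exact SignCounts.zero
  | cons x M ih =>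
    rw [Multiset.nodup_cons] at hnd
    have hx := h x (Multiset.mem_cons_self _ _)
    rw [Multiset.card_cons]
    exact (ih hnd.2 fun z hz => h z (Multiset.mem_cons_of_mem hz)).cons_neg hx.1 hx.2 hnd.1

theorem signCounts_symbolPoly_X_pow (m N : ℕ) :
    SignCounts ((symbolPoly (m + 1) (X ^ N)).aroots ℂ) N 0 0 0 := by
  classical
  obtain ⟨h0, hd, s, hs, hsr⟩ := symbolPoly_X_pow m N
  set F := symbolPoly (m + 1) (X ^ N)
  have hroots : F.aroots ℂ = (s.image ((↑) : ℝ → ℂ)).val := by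
    refine roots_eq_of_natDegree_le_card_of_ne_zero ?_ ?_ (map_ne_zero h0)
    · intro w hw
      obtain ⟨x, hx, rfl⟩ := Finset.mem_image.1 hw
      rw [eval_map_algebraMap, ← Complex.coe_algebraMap, aeval_algebraMap_apply_eq_algebraMap_eval,
        (hsr x hx).2, map_zero]
    · rw [natDegree_map, hd, Finset.card_image_of_injective _ Complex.ofReal_injective]
      exact hs
  have hcard := card_aroots F
  rw [hd] at hcard
  have := SignCounts.of_forall_neg (M := F.aroots ℂ) (hroots ▸ Finset.nodup _) (by
    intro z hz
    rw [hroots, Finset.mem_val] at hz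
    obtain ⟨x, hx, rfl⟩ := Finset.mem_image.1 hz
    exact ⟨Complex.ofReal_im x, by simpa using (hsr x hx).1⟩)
  rwa [hcard] at this

theorem natDegree_symbolPoly_le (k : ℕ) (Q : ℝ[X]) : (symbolPoly k Q).natDegree ≤ Q.natDegree := by
  have hpow : ∀ i, ((eulerOp k ^ i) 1).natDegree ≤ i := by
    intro i
    induction i with
    | zero => simp
    | succ i ih =>
      rw [pow_succ', Module.End.mul_apply]
      exact (natDegree_eulerOp_le k _).trans (by omega)
  rw [symbolPoly, aeval_eq_sum_range, LinearMap.sum_apply]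
  refine natDegree_sum_le_of_forall_le _ _ fun i hi => ?_
  rw [LinearMap.smul_apply]
  have := Finset.mem_range.1 hi
  exact (natDegree_smul_le _ _).trans ((hpow i).trans (by omega))

/-! ### Splitting zero roots of the symbol into small roots. -/

theorem SignCounts.natDegree_eq {F : ℝ[X]} {n z p c : ℕ} (h : SignCounts (F.aroots ℂ) n z p c) :
    F.natDegree = n + z + p + c := by
  rw [← card_aroots, h.card_eq]

theorem aeval_ofReal (F : ℝ[X]) (x : ℝ) : aeval (x : ℂ) F = ((F.eval x : ℝ) : ℂ) := by
  rw [← Complex.coe_algebraMap, aeval_algebraMap_apply_eq_algebraMap_eval]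

theorem notMem_aroots_ofReal {F : ℝ[X]} {x : ℝ} (h : F.eval x ≠ 0) : (x : ℂ) ∉ F.aroots ℂ := by
  intro hx
  have := (mem_aroots.1 hx).2
  rw [aeval_ofReal] at this
  exact h (by exact_mod_cast this)

theorem aroots_linear_mul {P : ℝ[X]} (hP : P ≠ 0) {B : ℝ[X]} {a r : ℂ} (ha : a ≠ 0)
    (hB : B.map (algebraMap ℝ ℂ) = C a * (X - C r)) :
    (B * P).aroots ℂ = r ::ₘ P.aroots ℂ := by
  have hB0 : B ≠ 0 := by
    rintro rfl
    rw [Polynomial.map_zero] at hB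
    exact mul_ne_zero (C_ne_zero.2 ha) (X_sub_C_ne_zero r) hB.symm
  rw [aroots_mul (mul_ne_zero hB0 hP), aroots_def B, hB, roots_C_mul _ ha, roots_X_sub_C,
    Multiset.singleton_add]

theorem aroots_quadratic_mul {P : ℝ[X]} (hP : P ≠ 0) {B : ℝ[X]} {a r s : ℂ} (ha : a ≠ 0)
    (hB : B.map (algebraMap ℝ ℂ) = C a * ((X - C r) * (X - C s))) :
    (B * P).aroots ℂ = r ::ₘ s ::ₘ P.aroots ℂ := by
  have h0 := mul_ne_zero (X_sub_C_ne_zero r) (X_sub_C_ne_zero s)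
  have hB0 : B ≠ 0 := by
    rintro rfl
    rw [Polynomial.map_zero] at hB
    exact mul_ne_zero (C_ne_zero.2 ha) h0 hB.symm
  rw [aroots_mul (mul_ne_zero hB0 hP), aroots_def B, hB, roots_C_mul _ ha, roots_mul h0,
    roots_X_sub_C, roots_X_sub_C, add_assoc, Multiset.singleton_add, Multiset.singleton_add]

theorem map_X_sq_add (t : ℝ) : (X ^ 2 + C (t ^ 2) : ℝ[X]).map (algebraMap ℝ ℂ) =
    C 1 * ((X - C (t * Complex.I)) * (X - C (-(t * Complex.I)))) := by
  have h : (C (t * Complex.I) * C (t * Complex.I) : ℂ[X]) = - C ((t : ℂ) ^ 2) := by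
    rw [← C_mul, ← C_neg]
    congr 1
    linear_combination (t : ℂ) ^ 2 * Complex.I_mul_I
  simp only [Polynomial.map_add, Polynomial.map_pow, map_X, map_C, C_neg, C_1, one_mul,
    Complex.coe_algebraMap, Complex.ofReal_pow]
  linear_combination h

/-- A polynomial `Q` with `b` positive roots, all less than `1`, and `c` non-real ones, for which
`symbolPoly k (X ^ a * Q)` has only simple negative roots. -/
structure SmallRoots (k a : ℕ) (Q : ℝ[X]) (b c : ℕ) : Prop where
  eval_pos : ∀ x : ℝ, 1 ≤ x → 0 < Q.eval x
  sign_zero : 0 < (-1) ^ b * Q.eval 0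
  roots : SignCounts (Q.aroots ℂ) 0 0 b c
  symbol : SignCounts ((symbolPoly k (X ^ a * Q)).aroots ℂ) (a + b + c) 0 0 0

namespace SmallRoots

variable {a b c : ℕ} {Q : ℝ[X]}

theorem ne_zero {k : ℕ} (h : SmallRoots k a Q b c) : Q ≠ 0 := by
  rintro rfl
  simpa using h.eval_pos 1 le_rfl

theorem eval_zero_ne {k : ℕ} (h : SmallRoots k a Q b c) : Q.eval 0 ≠ 0 := by
  intro h0
  simpa [h0] using h.sign_zero

theorem eval_add_pos {k : ℕ} (h : SmallRoots (k + 1) a Q b c) (j : ℕ) :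
    0 < (X ^ a * Q).eval ((j : ℝ) + ((k + 1 : ℕ) : ℝ)) := by
  have h1 : (1 : ℝ) ≤ (j : ℝ) + ((k + 1 : ℕ) : ℝ) := by
    have : (1 : ℝ) ≤ ((j + (k + 1) : ℕ) : ℝ) := by exact_mod_cast by omega
    exact_mod_cast this
  rw [eval_mul, eval_pow, eval_X]
  have := h.eval_pos _ h1
  positivity

theorem symbol_ne {k : ℕ} (h : SmallRoots (k + 1) a Q b c) :
    symbolPoly (k + 1) (X ^ a * Q) ≠ 0 := by
  have := symbolPoly_eval_pos (k + 1) h.eval_add_pos zero_le_one (by simp)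
  intro h0
  simp [h0] at this

theorem eventually_notMem {k : ℕ} (h : SmallRoots k a Q b c) {f : ℝ → ℂ} (hf : Continuous f)
    (hf0 : f 0 = 0) : ∀ᶠ t in 𝓝[>] (0 : ℝ), f t ∉ Q.aroots ℂ := by
  have h1 : Continuous fun t => aeval (f t) Q := Q.continuous_aeval.comp hf
  have h2 : aeval (f 0) Q ≠ 0 := by
    rw [hf0, ← Complex.ofReal_zero, aeval_ofReal]
    exact_mod_cast h.eval_zero_ne
  filter_upwards [(h1.continuousAt.eventually_ne h2).filter_mono nhdsWithin_le_nhds] with t ht hm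
  exact ht (mem_aroots.1 hm).2

/-- Replacing one factor `X` by `X - t` with small `t > 0` perturbs the image without raising its
degree, so its simple negative roots stay so. -/
theorem step_real {k : ℕ} (h : SmallRoots (k + 1) (a + 1) Q b c) :
    ∃ Q', SmallRoots (k + 1) a Q' (b + 1) c := by
  have hsym : ∀ t : ℝ, symbolPoly (k + 1) (X ^ a * ((X - C t) * Q)) =
      symbolPoly (k + 1) (X ^ (a + 1) * Q) + (-t) • symbolPoly (k + 1) (X ^ a * Q)
        + (0 : ℝ) • (0 : ℝ[X]) := by
    intro t
    rw [← symbolPoly_smul, smul_zero, add_zero, ← symbolPoly_add, smul_eq_C_mul, C_neg]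
    congr 1
    ring
  have hlim : Tendsto (fun t : ℝ => -t) (𝓝[>] 0) (𝓝 0) := by
    have : Tendsto (fun t : ℝ => -t) (𝓝 0) (𝓝 0) := by simpa using (continuous_neg (G := ℝ)).tendsto 0
    exact this.mono_left nhdsWithin_le_nhds
  have hF := PolyTendsto.add_smul_add_smul hlim (tendsto_const_nhds (x := (0 : ℝ)))
    (symbolPoly (k + 1) (X ^ (a + 1) * Q)) (symbolPoly (k + 1) (X ^ a * Q)) 0
  simp only [← hsym] at hF
  have hdeg : ∀ t : ℝ, (symbolPoly (k + 1) (X ^ a * ((X - C t) * Q))).natDegree ≤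
      (symbolPoly (k + 1) (X ^ (a + 1) * Q)).natDegree := by
    intro t
    refine (natDegree_symbolPoly_le _ _).trans ?_
    rw [h.symbol.natDegree_eq, natDegree_mul (by simp) (mul_ne_zero (X_sub_C_ne_zero t) h.ne_zero),
      natDegree_mul (X_sub_C_ne_zero t) h.ne_zero, natDegree_X_pow, natDegree_X_sub_C,
      h.roots.natDegree_eq]
    omega
  obtain ⟨t, hsc, ht, hnm⟩ := ((h.symbol.perturb_same hF h.symbol_ne
    (Eventually.of_forall hdeg)).and (Eventually.and
    (Ioo_mem_nhdsGT (zero_lt_one (α := ℝ))) (h.eventually_notMem Complex.continuous_ofReal Complex.ofReal_zero))).exists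
  refine ⟨(X - C t) * Q, ?_, ?_, ?_, ?_⟩
  · intro x hx
    rw [eval_mul, eval_sub, eval_X, eval_C]
    exact mul_pos (by linarith [ht.2]) (h.eval_pos x hx)
  · rw [eval_mul, eval_sub, eval_X, eval_C, pow_succ]
    have := mul_pos ht.1 h.sign_zero
    linarith
  · rw [aroots_linear_mul h.ne_zero (a := 1) (r := (t : ℂ)) one_ne_zero (by simp)]
    exact h.roots.cons_pos (Complex.ofReal_im t) (by simpa using ht.1) hnm
  · convert hsc using 1
    omega

theorem step_cplx {k : ℕ} (h : SmallRoots (k + 1) (a + 2) Q b c) :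
    ∃ Q', SmallRoots (k + 1) a Q' b (c + 2) := by
  have hsym : ∀ t : ℝ, symbolPoly (k + 1) (X ^ a * ((X ^ 2 + C (t ^ 2)) * Q)) =
      symbolPoly (k + 1) (X ^ (a + 2) * Q) + (t ^ 2) • symbolPoly (k + 1) (X ^ a * Q)
        + (0 : ℝ) • (0 : ℝ[X]) := by
    intro t
    rw [← symbolPoly_smul, smul_zero, add_zero, ← symbolPoly_add, smul_eq_C_mul]
    congr 1
    ring
  have hlim : Tendsto (fun t : ℝ => t ^ 2) (𝓝[>] 0) (𝓝 0) := by
    have : Tendsto (fun t : ℝ => t ^ 2) (𝓝 0) (𝓝 0) := by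
      simpa using (continuous_pow (M := ℝ) 2).tendsto 0
    exact this.mono_left nhdsWithin_le_nhds
  have hF := PolyTendsto.add_smul_add_smul hlim (tendsto_const_nhds (x := (0 : ℝ)))
    (symbolPoly (k + 1) (X ^ (a + 2) * Q)) (symbolPoly (k + 1) (X ^ a * Q)) 0
  simp only [← hsym] at hF
  have hX : ∀ t : ℝ, (X ^ 2 + C (t ^ 2) : ℝ[X]) ≠ 0 := fun t =>
    (monic_X_pow_add_C _ two_ne_zero).ne_zero
  have hdeg : ∀ t : ℝ, (symbolPoly (k + 1) (X ^ a * ((X ^ 2 + C (t ^ 2)) * Q))).natDegree ≤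
      (symbolPoly (k + 1) (X ^ (a + 2) * Q)).natDegree := by
    intro t
    refine (natDegree_symbolPoly_le _ _).trans ?_
    rw [h.symbol.natDegree_eq, natDegree_mul (by simp) (mul_ne_zero (hX t) h.ne_zero),
      natDegree_mul (hX t) h.ne_zero, natDegree_X_pow, natDegree_X_pow_add_C,
      h.roots.natDegree_eq]
    omega
  obtain ⟨t, hsc, ht, hnm, hnm'⟩ := ((h.symbol.perturb_same hF h.symbol_ne
    (Eventually.of_forall hdeg)).and (eventually_mem_nhdsWithin.and
    ((h.eventually_notMem (f := fun t : ℝ => (t : ℂ) * Complex.I) (by fun_prop) (by simp)).and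
    (h.eventually_notMem (f := fun t : ℝ => -((t : ℂ) * Complex.I)) (by fun_prop)
      (by simp))))).exists
  replace ht : 0 < t := ht
  refine ⟨(X ^ 2 + C (t ^ 2)) * Q, ?_, ?_, ?_, ?_⟩
  · intro x hx
    rw [eval_mul]
    refine mul_pos ?_ (h.eval_pos x hx)
    simp
    positivity
  · have h1 : ((X ^ 2 + C (t ^ 2)) * Q).eval 0 = t ^ 2 * Q.eval 0 := by simp
    rw [h1]
    have := mul_pos (pow_pos ht 2) h.sign_zero
    linarith
  · rw [aroots_quadratic_mul h.ne_zero one_ne_zero (map_X_sq_add t)]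
    refine (h.roots.cons_cplx ?_ hnm').cons_cplx ?_ ?_
    · simpa using ht.ne'
    · simpa using ht.ne'
    · rw [Multiset.mem_cons, not_or]
      refine ⟨fun h => ?_, hnm⟩
      have := congrArg Complex.im h
      simp at this
      linarith
  · convert hsc using 1
    omega

theorem exists_smallRoots (k a b e : ℕ) : ∃ Q, SmallRoots (k + 1) a Q b (2 * e) := by
  induction e generalizing a with
  | zero =>
    induction b generalizing a with
    | zero =>
      refine ⟨1, by simp, by simp, by simpa using SignCounts.zero, ?_⟩
      simpa using signCounts_symbolPoly_X_pow k a
    | succ b ih =>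
      obtain ⟨Q, hQ⟩ := ih (a + 1)
      exact hQ.step_real
  | succ e ih =>
    obtain ⟨Q, hQ⟩ := ih (a + 2)
    exact hQ.step_cplx

/-- The falling factorial contributes the roots `0, 1, …, m`; the positive ones are new because `Q`
is positive on `[1, ∞)`. -/
theorem signCounts_descPochhammer_mul {k : ℕ} (h : SmallRoots k a Q b c) (m : ℕ) :
    SignCounts ((descPochhammer ℝ (m + 1) * (X ^ a * Q)).aroots ℂ) 0 (a + 1) (m + b) c := by
  have hXQ : (X ^ a * Q : ℝ[X]) ≠ 0 := mul_ne_zero (by simp) h.ne_zero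
  induction m with
  | zero =>
    rw [zero_add, descPochhammer_one, ← mul_assoc, ← pow_succ', aroots_mul
      (mul_ne_zero (by simp) h.ne_zero), aroots_X_pow]
    simpa using h.roots.nsmul_zero_add (a + 1)
  | succ m ih =>
    have h1 : (descPochhammer ℝ (m + 1 + 1) * (X ^ a * Q) : ℝ[X]) =
        (X - C ((m + 1 : ℕ) : ℝ)) * (descPochhammer ℝ (m + 1) * (X ^ a * Q)) := by
      rw [descPochhammer_succ_right, C_eq_natCast]
      ring
    rw [h1, aroots_linear_mul (mul_ne_zero (monic_descPochhammer ℝ _).ne_zero hXQ) (a := 1)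
      (r := (((m + 1 : ℕ) : ℝ) : ℂ)) one_ne_zero (by simp)]
    have h2 := ih.cons_pos (x := (((m + 1 : ℕ) : ℝ) : ℂ)) (Complex.ofReal_im _)
      (by rw [Complex.ofReal_re]; positivity) (notMem_aroots_ofReal ?_)
    · convert h2 using 1
      omega
    · rw [eval_mul, eval_mul, eval_pow, eval_X]
      have h3 : (0 : ℝ) < (descPochhammer ℝ (m + 1)).eval ((m + 1 : ℕ) : ℝ) :=
        descPochhammer_pos (by simp)
      have h4 := h.eval_pos ((m + 1 : ℕ) : ℝ) (by simp)
      positivity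

end SmallRoots

/-! ### The last small roots when zero must not be a root. -/

/-- If a real polynomial with simple real roots, zero among them, is perturbed to one that is
positive on `[0, ∞)`, then all roots become negative. -/
theorem signCounts_perturb_X_mul {α : Type*} {l : Filter α} {S : ℝ[X]} {F : α → ℝ[X]} {n : ℕ}
    (hF : PolyTendsto F l (X * S)) (h0 : S ≠ 0) (h : SignCounts (S.aroots ℂ) n 0 0 0)
    (hdeg : ∀ᶠ t in l, (F t).natDegree ≤ n + 1) (hpos : ∀ᶠ t in l, ∀ x, 0 ≤ x → 0 < (F t).eval x) :
    ∀ᶠ t in l, SignCounts ((F t).aroots ℂ) (n + 1) 0 0 0 := by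
  have hroots : (X * S).aroots ℂ = 0 ::ₘ S.aroots ℂ := by
    rw [aroots_mul (mul_ne_zero X_ne_zero h0), aroots_X, Multiset.singleton_add]
  have hnd : ((X * S).aroots ℂ).Nodup := by
    rw [hroots, Multiset.nodup_cons]
    exact ⟨h.zero_notMem, h.nodup⟩
  obtain ⟨D, hD⟩ := hF.degree_le
  obtain ⟨M, hM⟩ := roots_perturb hnd (mul_ne_zero X_ne_zero h0) hD hF.eval hF.eval_derivative
    one_pos
  filter_upwards [hM, hdeg, hpos] with t ht hd hp
  obtain ⟨hnd', f, hfr, hf⟩ := ht ∅ (by simp) (by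
    rw [natDegree_X_mul h0, h.natDegree_eq]; simpa using hd)
  simp only [Finset.empty_val, add_zero] at hfr
  have hcard : Multiset.card ((F t).aroots ℂ) = n + 1 := by
    rw [hfr, Multiset.card_map, hroots, Multiset.card_cons, h.card_eq]
  rw [← hcard]
  refine SignCounts.of_forall_neg hnd' fun z hz => ?_
  have hi : z.im = 0 := by
    rw [hfr] at hz
    obtain ⟨w, hw, rfl⟩ := Multiset.mem_map.1 hz
    refine (hf w hw).2.2 ?_
    rw [hroots, Multiset.mem_cons] at hw
    rcases hw with rfl | hw
    · simp
    · by_contra hi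
      exact Multiset.countP_eq_zero.1 h.card_cplx w hw hi
  refine ⟨hi, ?_⟩
  by_contra! hr
  have hz' : ((z.re : ℝ) : ℂ) = z := Complex.ext (by simp) (by simp [hi])
  rw [← hz'] at hz
  exact notMem_aroots_ofReal (hp _ hr).ne' hz

theorem symbolPoly_zero_X_mul (Q : ℝ[X]) : symbolPoly 0 (X * Q) = X * symbolPoly 1 Q := by
  simpa using symbolPoly_zero_descPochhammer_mul 1 Q

theorem symbolPoly_zero_eval_pos {Q : ℝ[X]} (h0 : 0 < Q.eval 0) (h1 : ∀ x, 1 ≤ x → 0 < Q.eval x)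
    {x : ℝ} (hx : 0 ≤ x) : 0 < (symbolPoly 0 Q).eval x := by
  refine symbolPoly_eval_pos 0 (fun j => ?_) hx (by simp)
  rcases Nat.eq_zero_or_pos j with rfl | hj
  · simpa using h0
  · refine h1 _ ?_
    have : (1 : ℝ) ≤ j := by exact_mod_cast hj
    simpa using this

/-- As `t → 0` the image tends to `X * symbolPoly 1 Q`, whose root 0 must move left. With `b` odd,
`Q` is negative at 0, so the extra factor `X - t` makes the value at 0 positive, hence all series
coefficients. -/
theorem SmallRoots.step_real_zero {b c : ℕ} {Q : ℝ[X]} (h : SmallRoots 1 0 Q b c)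
    (hb : Odd b) : ∃ Q' : ℝ[X], 0 < Q'.eval 0 ∧ (∀ x, 1 ≤ x → 0 < Q'.eval x) ∧
      SignCounts (Q'.aroots ℂ) 0 0 (b + 1) c ∧
      SignCounts ((symbolPoly 0 Q').aroots ℂ) (b + 1 + c) 0 0 0 := by
  have hsym : ∀ t : ℝ, symbolPoly 0 ((X - C t) * Q) =
      X * symbolPoly 1 (X ^ 0 * Q) + (-t) • symbolPoly 0 Q + (0 : ℝ) • (0 : ℝ[X]) := by
    intro t
    rw [pow_zero, one_mul, ← symbolPoly_zero_X_mul, ← symbolPoly_smul, smul_zero, add_zero,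
      ← symbolPoly_add, smul_eq_C_mul, C_neg]
    congr 1
    ring
  have hlim : Tendsto (fun t : ℝ => -t) (𝓝[>] 0) (𝓝 0) := by
    have : Tendsto (fun t : ℝ => -t) (𝓝 0) (𝓝 0) := by simpa using (continuous_neg (G := ℝ)).tendsto 0
    exact this.mono_left nhdsWithin_le_nhds
  have hF := PolyTendsto.add_smul_add_smul hlim (tendsto_const_nhds (x := (0 : ℝ)))
    (X * symbolPoly 1 (X ^ 0 * Q)) (symbolPoly 0 Q) 0
  simp only [← hsym] at hF
  have hdeg : ∀ t : ℝ, (symbolPoly 0 ((X - C t) * Q)).natDegree ≤ 0 + b + c + 1 := by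
    intro t
    refine (natDegree_symbolPoly_le _ _).trans ?_
    rw [natDegree_mul (X_sub_C_ne_zero t) h.ne_zero, natDegree_X_sub_C, h.roots.natDegree_eq]
    omega
  have hQ0 : Q.eval 0 < 0 := by
    have := h.sign_zero
    rw [hb.neg_one_pow] at this
    linarith
  have hpos : ∀ t : ℝ, 0 < t → t < 1 → 0 < ((X - C t) * Q).eval 0 ∧
      ∀ x, 1 ≤ x → 0 < ((X - C t) * Q).eval x := by
    intro t ht ht1
    constructor
    · rw [eval_mul, eval_sub, eval_X, eval_C]
      exact mul_pos_of_neg_of_neg (by linarith) hQ0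
    · intro x hx
      rw [eval_mul, eval_sub, eval_X, eval_C]
      exact mul_pos (by linarith) (h.eval_pos x hx)
  have hI := Ioo_mem_nhdsGT (zero_lt_one (α := ℝ))
  obtain ⟨t, hsc, ht, hnm⟩ := ((signCounts_perturb_X_mul hF h.symbol_ne h.symbol
    (Eventually.of_forall hdeg) (by
      filter_upwards [hI] with t ht x hx
      exact symbolPoly_zero_eval_pos (hpos t ht.1 ht.2).1 (hpos t ht.1 ht.2).2 hx)).and
    (Eventually.and hI
    (h.eventually_notMem Complex.continuous_ofReal Complex.ofReal_zero))).exists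
  refine ⟨(X - C t) * Q, (hpos t ht.1 ht.2).1, (hpos t ht.1 ht.2).2, ?_, ?_⟩
  · rw [aroots_linear_mul h.ne_zero (a := 1) (r := (t : ℂ)) one_ne_zero (by simp)]
    exact h.roots.cons_pos (Complex.ofReal_im t) (by simpa using ht.1) hnm
  · convert hsc using 1
    omega

theorem SmallRoots.step_cplx_zero {b c : ℕ} {Q : ℝ[X]} (h : SmallRoots 1 1 Q b c)
    (hb : Even b) : ∃ Q' : ℝ[X], 0 < Q'.eval 0 ∧ (∀ x, 1 ≤ x → 0 < Q'.eval x) ∧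
      SignCounts (Q'.aroots ℂ) 0 0 b (c + 2) ∧
      SignCounts ((symbolPoly 0 Q').aroots ℂ) (b + (c + 2)) 0 0 0 := by
  have hsym : ∀ t : ℝ, symbolPoly 0 ((X ^ 2 + C (t ^ 2)) * Q) =
      X * symbolPoly 1 (X ^ 1 * Q) + (t ^ 2) • symbolPoly 0 Q + (0 : ℝ) • (0 : ℝ[X]) := by
    intro t
    rw [pow_one, ← symbolPoly_zero_X_mul, ← symbolPoly_smul, smul_zero, add_zero,
      ← symbolPoly_add, smul_eq_C_mul]
    congr 1
    ring
  have hlim : Tendsto (fun t : ℝ => t ^ 2) (𝓝[>] 0) (𝓝 0) := by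
    have : Tendsto (fun t : ℝ => t ^ 2) (𝓝 0) (𝓝 0) := by
      simpa using (continuous_pow (M := ℝ) 2).tendsto 0
    exact this.mono_left nhdsWithin_le_nhds
  have hF := PolyTendsto.add_smul_add_smul hlim (tendsto_const_nhds (x := (0 : ℝ)))
    (X * symbolPoly 1 (X ^ 1 * Q)) (symbolPoly 0 Q) 0
  simp only [← hsym] at hF
  have hX : ∀ t : ℝ, (X ^ 2 + C (t ^ 2) : ℝ[X]) ≠ 0 := fun t =>
    (monic_X_pow_add_C _ two_ne_zero).ne_zero
  have hdeg : ∀ t : ℝ, (symbolPoly 0 ((X ^ 2 + C (t ^ 2)) * Q)).natDegree ≤ 1 + b + c + 1 := by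
    intro t
    refine (natDegree_symbolPoly_le _ _).trans ?_
    rw [natDegree_mul (hX t) h.ne_zero, natDegree_X_pow_add_C, h.roots.natDegree_eq]
    omega
  have hQ0 : 0 < Q.eval 0 := by
    have := h.sign_zero
    rwa [hb.neg_one_pow, one_mul] at this
  have hpos : ∀ t : ℝ, 0 < t → 0 < ((X ^ 2 + C (t ^ 2)) * Q).eval 0 ∧
      ∀ x, 1 ≤ x → 0 < ((X ^ 2 + C (t ^ 2)) * Q).eval x := by
    intro t ht
    constructor
    · simp
      positivity
    · intro x hx
      have := h.eval_pos x hx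
      simp
      positivity
  obtain ⟨t, hsc, ht, hnm, hnm'⟩ := ((signCounts_perturb_X_mul hF h.symbol_ne h.symbol
    (Eventually.of_forall hdeg) (by
      filter_upwards [self_mem_nhdsWithin] with t ht x hx
      exact symbolPoly_zero_eval_pos (hpos t ht).1 (hpos t ht).2 hx)).and
    (eventually_mem_nhdsWithin.and
    ((h.eventually_notMem (f := fun t : ℝ => (t : ℂ) * Complex.I) (by fun_prop) (by simp)).and
    (h.eventually_notMem (f := fun t : ℝ => -((t : ℂ) * Complex.I)) (by fun_prop)
      (by simp))))).exists
  replace ht : 0 < t := ht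
  refine ⟨(X ^ 2 + C (t ^ 2)) * Q, (hpos t ht).1, (hpos t ht).2, ?_, ?_⟩
  · rw [aroots_quadratic_mul h.ne_zero one_ne_zero (map_X_sq_add t)]
    refine (h.roots.cons_cplx ?_ hnm').cons_cplx ?_ ?_
    · simpa using ht.ne'
    · simpa using ht.ne'
    · rw [Multiset.mem_cons, not_or]
      refine ⟨fun h => ?_, hnm⟩
      have := congrArg Complex.im h
      simp at this
      linarith
  · convert hsc using 1
    omega

/-! ### Attaching large roots to the symbol. -/

/-- Multiplication by `1 + u X + v X ^ 2` of the symbol, seen on `symbolPoly`. -/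
theorem symbolPoly_quadratic_mul (k : ℕ) (Q : ℝ[X]) (u v : ℝ) :
    symbolPoly k ((1 + C u * X + C v * X ^ 2) * Q) = symbolPoly k Q +
      u • eulerOp k (symbolPoly k Q) + v • eulerOp k (eulerOp k (symbolPoly k Q)) := by
  rw [← symbolPoly_X_mul, ← symbolPoly_X_mul, ← symbolPoly_smul, ← symbolPoly_smul,
    ← symbolPoly_add, ← symbolPoly_add, smul_eq_C_mul, smul_eq_C_mul]
  congr 1
  ring

theorem tendsto_aeval_mul_div_pow {α : Type*} {l : Filter α} {r : α → ℝ} (hr : Tendsto r l atTop)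
    {F : ℝ[X]} {m : ℕ} (hF : F.natDegree ≤ m) (y : ℂ) :
    Tendsto (fun t => aeval (r t * y) F / (r t : ℂ) ^ m) l (𝓝 (F.coeff m * y ^ m)) := by
  have hinv : Tendsto (fun t => ((r t : ℂ))⁻¹) l (𝓝 0) := by
    have := (Complex.continuous_ofReal.tendsto 0).comp (tendsto_inv_atTop_zero.comp hr)
    simpa [Function.comp_def] using this
  have h1 : ∀ i ∈ Finset.range (m + 1), Tendsto
      (fun t => (F.coeff i : ℂ) * y ^ i * ((r t : ℂ))⁻¹ ^ (m - i)) l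
      (𝓝 ((F.coeff i : ℂ) * y ^ i * 0 ^ (m - i))) := fun i _ =>
    (hinv.pow _).const_mul _
  have h2 := tendsto_finsetSum _ h1
  have h3 : ∑ i ∈ Finset.range (m + 1), (F.coeff i : ℂ) * y ^ i * 0 ^ (m - i) =
      F.coeff m * y ^ m := by
    rw [Finset.sum_eq_single m]
    · simp
    · intro i hi him
      have : m - i ≠ 0 := by have := Finset.mem_range.1 hi; omega
      rw [zero_pow this, mul_zero]
    · simp
  rw [h3] at h2
  refine h2.congr' ?_
  filter_upwards [hr.eventually_gt_atTop 0] with t ht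
  have ht' : (r t : ℂ) ≠ 0 := by exact_mod_cast ht.ne'
  rw [aeval_eq_sum_range' (Nat.lt_succ_of_le hF), Finset.sum_div]
  refine Finset.sum_congr rfl fun i hi => ?_
  have hi' : i ≤ m := Nat.lt_succ_iff.1 (Finset.mem_range.1 hi)
  obtain ⟨j, rfl⟩ := Nat.exists_eq_add_of_le hi'
  rw [Complex.real_smul, Nat.add_sub_cancel_left, mul_pow, pow_add, inv_pow]
  field_simp

/-- At scale `r` the operator acts on leading terms as multiplication by `x`: `F(r y) / r^d` tends
to `lc(S) y^d (1 + β₁ y + β₂ y²)`, which vanishes at the chosen `y`. The bound `κ` keeps the leading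
coefficient from being too small. -/
theorem exists_large_root {α : Type*} {l : Filter α} (k : ℕ) {S : ℝ[X]} {r u v : α → ℝ}
    (hr : Tendsto r l atTop) {β₁ β₂ : ℝ} (hu : Tendsto (fun t => r t * u t) l (𝓝 β₁))
    (hv : Tendsto (fun t => r t ^ 2 * v t) l (𝓝 β₂)) {y : ℂ} (hy : 1 + β₁ * y + β₂ * y ^ 2 = 0)
    {F : α → ℝ[X]} (hF : ∀ t, F t = S + u t • eulerOp k S + v t • eulerOp k (eulerOp k S))
    {e : ℕ} {κ : ℝ} (hκ : 0 < κ) (hlead : ∀ᶠ t in l, (F t).natDegree = S.natDegree + e ∧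
      κ ≤ |(F t).leadingCoeff| * r t ^ e) :
    ∀ᶠ t in l, ∃ w ∈ (F t).aroots ℂ, ‖w - r t * y‖ < r t / 2 := by
  set d := S.natDegree with hd
  have hd1 : (eulerOp k S).natDegree ≤ d + 1 := natDegree_eulerOp_le k S
  have hd2 : (eulerOp k (eulerOp k S)).natDegree ≤ d + 2 :=
    (natDegree_eulerOp_le k _).trans (by omega)
  have hc1 : (eulerOp k S).coeff (d + 1) = S.coeff d := coeff_eulerOp k le_rfl
  have hc2 : (eulerOp k (eulerOp k S)).coeff (d + 2) = S.coeff d := by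
    rw [coeff_eulerOp k hd1, hc1]
  have hlim : Tendsto (fun t => aeval (r t * y) (F t) / (r t : ℂ) ^ d) l (𝓝 0) := by
    have h0 := tendsto_aeval_mul_div_pow hr (F := S) le_rfl y
    have h1 := tendsto_aeval_mul_div_pow hr hd1 y
    have h2 := tendsto_aeval_mul_div_pow hr hd2 y
    have hu' := (Complex.continuous_ofReal.tendsto β₁).comp hu
    have hv' := (Complex.continuous_ofReal.tendsto β₂).comp hv
    have h3 := (h0.add (hu'.mul h1)).add (hv'.mul h2)
    rw [hc1, hc2, ← hd] at h3
    have h4 : (S.coeff d : ℂ) * y ^ d + β₁ * (S.coeff d * y ^ (d + 1)) +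
        β₂ * (S.coeff d * y ^ (d + 2)) = 0 := by
      linear_combination (S.coeff d : ℂ) * y ^ d * hy
    rw [h4] at h3
    refine h3.congr' ?_
    filter_upwards [hr.eventually_gt_atTop 0] with t ht
    have ht' : (r t : ℂ) ≠ 0 := by exact_mod_cast ht.ne'
    simp only [Function.comp, hF, map_add, map_smul, Complex.real_smul, Complex.ofReal_mul,
      Complex.ofReal_pow]
    field_simp
    ring
  -- The power of 2 comes from the radius `r/2` raised to the degree `d + e`.
  have hsmall := hlim.norm.eventually_lt_const (u := κ / 2 ^ (d + e)) (by
    rw [norm_zero]; positivity)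
  filter_upwards [hsmall, hlead, hr.eventually_gt_atTop 0] with t hs ⟨hdeg, hκt⟩ ht
  refine exists_root_near_of_norm_lt _ _ (by positivity) ?_
  rw [eval_map_algebraMap, leadingCoeff_map, natDegree_map, hdeg, Complex.coe_algebraMap,
    Complex.norm_real, Real.norm_eq_abs]
  rw [norm_div, norm_pow, Complex.norm_real, Real.norm_eq_abs, abs_of_pos ht,
    div_lt_iff₀ (by positivity)] at hs
  calc _ < κ / 2 ^ (d + e) * r t ^ d := hs
    _ ≤ |(F t).leadingCoeff| * r t ^ e / 2 ^ (d + e) * r t ^ d := by gcongr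
    _ = _ := by
      rw [div_pow, pow_add (r t)]
      ring

/-- Sign patterns of the roots of `symbolPoly k Q` and of `descPochhammer ℝ k * Q`. -/
structure RootPair (k : ℕ) (Q : ℝ[X]) (n p c n' z' p' c' : ℕ) : Prop where
  ne_zero : Q ≠ 0
  symbol_ne_zero : symbolPoly k Q ≠ 0
  symbol : SignCounts ((symbolPoly k Q).aroots ℂ) n 0 p c
  roots : SignCounts ((descPochhammer ℝ k * Q).aroots ℂ) n' z' p' c'

namespace RootPair

variable {k n p c n' z' p' c' : ℕ} {Q : ℝ[X]}

theorem prod_ne_zero (h : RootPair k Q n p c n' z' p' c') : descPochhammer ℝ k * Q ≠ 0 :=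
  mul_ne_zero (monic_descPochhammer ℝ k).ne_zero h.ne_zero

theorem eventually_norm_lt {α : Type*} {l : Filter α} {r : α → ℝ} (hr : Tendsto r l atTop)
    (M : Multiset ℂ) : ∀ᶠ t in l, ∀ w ∈ M, ‖w‖ < r t := by
  obtain ⟨B, hB⟩ := (M.toFinset.finite_toSet).isBounded.exists_norm_le
  filter_upwards [hr.eventually_gt_atTop B] with t ht w hw
  exact (hB w (by simpa using hw)).trans_lt ht

theorem quadratic_mul_comm (k : ℕ) (Q B : ℝ[X]) :
    descPochhammer ℝ k * (B * Q) = B * (descPochhammer ℝ k * Q) := by ring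

theorem natDegree_quadratic_le (k : ℕ) (S : ℝ[X]) (u v : ℝ) :
    (S + u • eulerOp k S + v • eulerOp k (eulerOp k S)).natDegree ≤ S.natDegree + 2 := by
  have h1 := natDegree_eulerOp_le k S
  have h2 := natDegree_eulerOp_le k (eulerOp k S)
  refine (natDegree_add_le _ _).trans (max_le ((natDegree_add_le _ _).trans (max_le ?_ ?_)) ?_)
  · omega
  · exact (natDegree_smul_le _ _).trans (by omega)
  · exact (natDegree_smul_le _ _).trans (by omega)

theorem natDegree_linear_le (k : ℕ) (S : ℝ[X]) (u : ℝ) :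
    (S + u • eulerOp k S).natDegree ≤ S.natDegree + 1 :=
  (natDegree_add_le _ _).trans (max_le (by omega)
    ((natDegree_smul_le _ _).trans (natDegree_eulerOp_le k S)))

theorem coeff_linear (k : ℕ) (S : ℝ[X]) (u : ℝ) :
    (S + u • eulerOp k S).coeff (S.natDegree + 1) = u * S.leadingCoeff := by
  rw [coeff_add, coeff_smul, coeff_eulerOp k le_rfl, coeff_eq_zero_of_natDegree_lt (by omega),
    zero_add, smul_eq_mul, leadingCoeff]

theorem coeff_quadratic (k : ℕ) (S : ℝ[X]) (u v : ℝ) :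
    (S + u • eulerOp k S + v • eulerOp k (eulerOp k S)).coeff (S.natDegree + 2) =
      v * S.leadingCoeff := by
  have h1 := natDegree_linear_le k S u
  rw [coeff_add, coeff_smul, coeff_eulerOp k (natDegree_eulerOp_le k S), coeff_eulerOp k le_rfl,
    coeff_eq_zero_of_natDegree_lt (by omega), zero_add, smul_eq_mul, leadingCoeff]

theorem leading_of_coeff {F : ℝ[X]} {m : ℕ} (h : F.natDegree ≤ m) (h0 : F.coeff m ≠ 0) :
    F.natDegree = m ∧ F.leadingCoeff = F.coeff m := by
  have := le_antisymm h (le_natDegree_of_ne_zero h0)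
  exact ⟨this, by rw [leadingCoeff, this]⟩

theorem exists_large_root_linear {σ : ℝ} (hσ : σ * σ = 1) (k : ℕ) {S : ℝ[X]} (hS : S ≠ 0) :
    ∀ᶠ t : ℝ in atTop, ∃ w ∈ (S + (-σ / t) • eulerOp k S).aroots ℂ, ‖w - t * σ‖ < t / 2 := by
  have hσ0 : σ ≠ 0 := by rintro rfl; simp at hσ
  have h1 : Tendsto (fun t : ℝ => t * (-σ / t)) atTop (𝓝 (-σ)) := by
    refine tendsto_const_nhds.congr' ?_
    filter_upwards [eventually_gt_atTop 0] with t ht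
    field_simp
  have h2 : Tendsto (fun t : ℝ => t ^ 2 * (0 : ℝ)) atTop (𝓝 0) := by simp
  refine exists_large_root k (S := S) (r := fun t => t) (u := fun t => -σ / t) (v := fun _ => 0) (e := 1)
    (κ := |σ * S.leadingCoeff|) tendsto_id h1 h2 ?_ (fun t => by simp) ?_ ?_
  · have : (σ : ℂ) * σ = 1 := by exact_mod_cast hσ
    push_cast
    linear_combination -this
  · exact abs_pos.2 (mul_ne_zero hσ0 (leadingCoeff_ne_zero.2 hS))
  · filter_upwards [eventually_gt_atTop 0] with t ht
    have hc := coeff_linear k S (-σ / t)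
    have hne : (-σ / t) * S.leadingCoeff ≠ 0 :=
      mul_ne_zero (div_ne_zero (neg_ne_zero.2 hσ0) ht.ne') (leadingCoeff_ne_zero.2 hS)
    obtain ⟨hd, hl⟩ := leading_of_coeff (natDegree_linear_le k S (-σ / t)) (hc ▸ hne)
    refine ⟨hd, ?_⟩
    rw [hl, hc, pow_one, abs_mul, abs_mul, abs_div, abs_neg, abs_of_pos ht]
    refine le_of_eq ?_
    field_simp

theorem exists_large_root_quadratic {α : Type*} {l : Filter α} (k : ℕ) {S : ℝ[X]} (hS : S ≠ 0)
    {r u v : α → ℝ} (hr : Tendsto r l atTop) {β₁ : ℝ}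
    (hu : Tendsto (fun t => r t * u t) l (𝓝 β₁)) (hv : Tendsto (fun t => r t ^ 2 * v t) l (𝓝 1))
    {y : ℂ} (hy : 1 + β₁ * y + y ^ 2 = 0) :
    ∀ᶠ t in l, ∃ w ∈ (S + u t • eulerOp k S + v t • eulerOp k (eulerOp k S)).aroots ℂ,
      ‖w - r t * y‖ < r t / 2 := by
  have hlc := abs_pos.2 (leadingCoeff_ne_zero.2 hS)
  refine exists_large_root k hr hu hv (by simpa using hy) (fun t => rfl) (e := 2)
    (κ := |S.leadingCoeff| / 2) (by positivity) ?_
  filter_upwards [hr.eventually_gt_atTop 0, hv.eventually_const_lt (u := 1 / 2) (by norm_num)]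
    with t ht hvt
  have hv0 : 0 < v t := by
    by_contra! hneg
    have := mul_nonpos_of_nonneg_of_nonpos (sq_nonneg (r t)) hneg
    linarith
  have hc := coeff_quadratic k S (u t) (v t)
  have hne : v t * S.leadingCoeff ≠ 0 := mul_ne_zero hv0.ne' (leadingCoeff_ne_zero.2 hS)
  obtain ⟨hd, hl⟩ := leading_of_coeff (natDegree_quadratic_le k S (u t) (v t)) (hc ▸ hne)
  refine ⟨hd, ?_⟩
  rw [hl, hc, abs_mul, abs_of_pos hv0]
  have := mul_le_mul_of_nonneg_left hvt.le hlc.le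
  linarith

theorem tendsto_div_atTop (σ : ℝ) : Tendsto (fun t : ℝ => σ / t) atTop (𝓝 0) :=
  tendsto_const_nhds.div_atTop tendsto_id

theorem large_of_near {t σ : ℝ} {w : ℂ} (hσ : σ * σ = 1) (h : ‖w - t * σ‖ < t / 2) :
    t / 2 < ‖w‖ ∧ t / 2 < σ * w.re := by
  have h1 := (Complex.abs_re_le_norm (w - t * σ)).trans_lt h
  have h2 : (w - t * σ).re = w.re - t * σ := by simp
  rw [h2] at h1
  have habs : |σ| = 1 := by
    have h3 := abs_mul_abs_self σ
    rw [hσ] at h3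
    nlinarith [abs_nonneg σ]
  have h4 : |σ * w.re - t| < t / 2 := by
    have : σ * w.re - t = σ * (w.re - t * σ) := by linear_combination t * hσ
    rw [this, abs_mul, habs, one_mul]
    exact h1
  have h5 := (abs_lt.1 h4).1
  have h6 : t / 2 < σ * w.re := by linarith
  refine ⟨h6.trans_le ?_, h6⟩
  calc σ * w.re ≤ |σ * w.re| := le_abs_self _
    _ = |w.re| := by rw [abs_mul, habs, one_mul]
    _ ≤ ‖w‖ := Complex.abs_re_le_norm w

theorem linear_step (h : RootPair k Q n p c n' z' p' c') {σ : ℝ} (hσ : σ * σ = 1) :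
    PolyTendsto (fun t : ℝ => symbolPoly k ((1 + C (-σ / t) * X) * Q)) atTop (symbolPoly k Q) ∧
    (∀ t : ℝ, (symbolPoly k ((1 + C (-σ / t) * X) * Q)).natDegree ≤
      (symbolPoly k Q).natDegree + 1) ∧
    (∀ M : ℝ, ∀ᶠ t : ℝ in atTop, ∃ w ∈ (symbolPoly k ((1 + C (-σ / t) * X) * Q)).aroots ℂ,
      M < ‖w‖ ∧ 0 < σ * w.re) ∧
    ∀ᶠ t : ℝ in atTop, 0 < t ∧ (1 + C (-σ / t) * X) * Q ≠ 0 ∧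
      (descPochhammer ℝ k * ((1 + C (-σ / t) * X) * Q)).aroots ℂ =
        ((t * σ : ℝ) : ℂ) ::ₘ (descPochhammer ℝ k * Q).aroots ℂ ∧
      ((t * σ : ℝ) : ℂ) ∉ (descPochhammer ℝ k * Q).aroots ℂ := by
  have hsym : ∀ t : ℝ, symbolPoly k ((1 + C (-σ / t) * X) * Q) =
      symbolPoly k Q + (-σ / t) • eulerOp k (symbolPoly k Q) := by
    intro t
    simpa using symbolPoly_quadratic_mul k Q (-σ / t) 0
  simp only [hsym]
  refine ⟨?_, fun t => natDegree_linear_le k _ _, fun M => ?_, ?_⟩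
  · simpa using PolyTendsto.add_smul_add_smul (tendsto_div_atTop (-σ))
      (tendsto_const_nhds (x := (0 : ℝ))) (symbolPoly k Q) (eulerOp k (symbolPoly k Q)) 0
  · filter_upwards [exists_large_root_linear hσ k h.symbol_ne_zero, eventually_gt_atTop (2 * M),
      eventually_gt_atTop 0] with t ⟨w, hw, hwt⟩ htM ht
    obtain ⟨h1, h2⟩ := large_of_near hσ hwt
    exact ⟨w, hw, by linarith, by linarith⟩
  · filter_upwards [eventually_gt_atTop 0,
      eventually_norm_lt tendsto_id ((descPochhammer ℝ k * Q).aroots ℂ)] with t ht hnorm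
    have hσ0 : σ ≠ 0 := by rintro rfl; simp at hσ
    have hu : ((-σ / t : ℝ) : ℂ) ≠ 0 := by
      exact_mod_cast div_ne_zero (neg_ne_zero.2 hσ0) ht.ne'
    refine ⟨ht, ?_, ?_, fun hm => ?_⟩
    · refine mul_ne_zero (fun h0 => ?_) h.ne_zero
      have := congrArg (eval 0) h0
      simp at this
    · rw [quadratic_mul_comm]
      refine aroots_linear_mul h.prod_ne_zero hu ?_
      have h1 : ((-σ / t : ℝ) : ℂ) * ((t * σ : ℝ) : ℂ) = -1 := by
        have : (-σ / t) * (t * σ) = -1 := by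
          field_simp
          linarith
        exact_mod_cast this
      rw [mul_sub, ← C_mul, h1]
      simp
      ring
    · have h1 := hnorm _ hm
      have habs : |σ| = 1 := by
        have h3 := abs_mul_abs_self σ
        rw [hσ] at h3
        nlinarith [abs_nonneg σ]
      rw [Complex.norm_real, Real.norm_eq_abs, abs_mul, habs, abs_of_pos ht] at h1
      simp at h1

theorem add_pos (h : RootPair k Q n p c n' z' p' c') :
    ∃ Q', RootPair k Q' n (p + 1) c n' z' (p' + 1) c' := by
  obtain ⟨hF, hdeg, hlarge, hP⟩ := h.linear_step (σ := 1) (by norm_num)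
  obtain ⟨t, hsc, ht, hne, hr, hnm⟩ := ((h.symbol.perturb_pos hF h.symbol_ne_zero
    (Eventually.of_forall hdeg) (by simpa using hlarge)).and hP).exists
  refine ⟨_, hne, ?_, hsc, ?_⟩
  · intro h0
    rw [h0] at hsc
    have := hsc.card_eq
    simp at this
    omega
  · rw [hr]
    exact h.roots.cons_pos (Complex.ofReal_im _) (by rw [Complex.ofReal_re]; linarith) hnm

theorem add_neg (h : RootPair k Q n p c n' z' p' c') :
    ∃ Q', RootPair k Q' (n + 1) p c (n' + 1) z' p' c' := by
  obtain ⟨hF, hdeg, hlarge, hP⟩ := h.linear_step (σ := -1) (by norm_num)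
  obtain ⟨t, hsc, ht, hne, hr, hnm⟩ := ((h.symbol.perturb_neg hF h.symbol_ne_zero
    (Eventually.of_forall hdeg) (by simpa using hlarge)).and hP).exists
  refine ⟨_, hne, ?_, hsc, ?_⟩
  · intro h0
    rw [h0] at hsc
    have := hsc.card_eq
    simp at this
    omega
  · rw [hr]
    exact h.roots.cons_neg (Complex.ofReal_im _) (by rw [Complex.ofReal_re]; linarith) hnm

/-- The factor `1 + X²/t²` gives `Q` the pair `± i t`; at scale `t` the limit `1 + y²` has root `i`,
so `S` gains a root near `i t`. -/
theorem add_cplx (h : RootPair k Q n p c n' z' p' c') :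
    ∃ Q', RootPair k Q' n p (c + 2) n' z' p' (c' + 2) := by
  have hsym : ∀ t : ℝ, symbolPoly k ((1 + C 0 * X + C (1 / t ^ 2) * X ^ 2) * Q) =
      symbolPoly k Q + (0 : ℝ) • eulerOp k (symbolPoly k Q) +
        (1 / t ^ 2) • eulerOp k (eulerOp k (symbolPoly k Q)) :=
    fun t => symbolPoly_quadratic_mul k Q 0 (1 / t ^ 2)
  have hv0 : Tendsto (fun t : ℝ => 1 / t ^ 2) atTop (𝓝 0) :=
    tendsto_const_nhds.div_atTop (tendsto_pow_atTop two_ne_zero)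
  have hF := PolyTendsto.add_smul_add_smul (tendsto_const_nhds (x := (0 : ℝ))) hv0
    (symbolPoly k Q) (eulerOp k (symbolPoly k Q)) (eulerOp k (eulerOp k (symbolPoly k Q)))
  have hv : Tendsto (fun t : ℝ => t ^ 2 * (1 / t ^ 2)) atTop (𝓝 1) := by
    refine tendsto_const_nhds.congr' ?_
    filter_upwards [eventually_gt_atTop 0] with t ht
    field_simp
  have hlarge : ∀ M : ℝ, ∀ᶠ t : ℝ in atTop, ∃ w ∈ (symbolPoly k Q +
      (0 : ℝ) • eulerOp k (symbolPoly k Q) +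
        (1 / t ^ 2) • eulerOp k (eulerOp k (symbolPoly k Q))).aroots ℂ, M < ‖w‖ ∧ w.im ≠ 0 := by
    intro M
    filter_upwards [exists_large_root_quadratic k h.symbol_ne_zero tendsto_id
      (u := fun _ => (0 : ℝ)) (β₁ := 0) (by simp) hv (y := Complex.I) (by simp),
      eventually_gt_atTop (2 * M), eventually_gt_atTop 0] with t ⟨w, hw, hwt⟩ htM ht
    have h1 := (Complex.abs_im_le_norm (w - t * Complex.I)).trans_lt hwt
    have h2 : (w - t * Complex.I).im = w.im - t := by simp
    rw [h2, abs_lt] at h1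
    have h3 : t / 2 < w.im := by simp only [id] at h1; linarith [h1.1]
    have h4 := (le_abs_self w.im).trans (Complex.abs_im_le_norm w)
    exact ⟨w, hw, by linarith, by linarith⟩
  obtain ⟨t, hsc, ht, hnorm⟩ := ((h.symbol.perturb_cplx hF h.symbol_ne_zero
    (Eventually.of_forall fun t => natDegree_quadratic_le k _ _ _) hlarge).and
    ((eventually_gt_atTop 0).and
      (eventually_norm_lt tendsto_id ((descPochhammer ℝ k * Q).aroots ℂ)))).exists
  have htc : (t : ℂ) ≠ 0 := by exact_mod_cast ht.ne'
  have hnm : ∀ w ∈ (descPochhammer ℝ k * Q).aroots ℂ, ‖w‖ ≠ t := fun w hw => (hnorm w hw).ne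
  rw [← hsym] at hsc
  refine ⟨(1 + C 0 * X + C (1 / t ^ 2) * X ^ 2) * Q, ?_, ?_, hsc, ?_⟩
  · refine mul_ne_zero (fun h0 => ?_) h.ne_zero
    have := congrArg (eval 0) h0
    simp at this
  · intro h0
    rw [h0] at hsc
    have := hsc.card_eq
    simp at this
  · have hB : (1 + C 0 * X + C (1 / t ^ 2) * X ^ 2 : ℝ[X]).map (algebraMap ℝ ℂ) =
        C (1 / (t : ℂ) ^ 2) * ((X - C (t * Complex.I)) * (X - C (-(t * Complex.I)))) := by
      have h1 : (1 + C 0 * X + C (1 / t ^ 2) * X ^ 2 : ℝ[X]) =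
          C (1 / t ^ 2) * (X ^ 2 + C (t ^ 2)) := by
        rw [mul_add, ← C_mul, one_div_mul_cancel (pow_ne_zero 2 ht.ne')]
        simp
        ring
      rw [h1, Polynomial.map_mul, map_X_sq_add]
      simp
    rw [quadratic_mul_comm, aroots_quadratic_mul h.prod_ne_zero (one_div_ne_zero (pow_ne_zero 2 htc)) hB]
    have hnI : ‖(t : ℂ) * Complex.I‖ = t := by
      rw [norm_mul, Complex.norm_I, mul_one, Complex.norm_real, Real.norm_eq_abs, abs_of_pos ht]
    refine (h.roots.cons_cplx ?_ fun hm => hnm _ hm ?_).cons_cplx ?_ ?_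
    · simpa using ht.ne'
    · rw [norm_neg, hnI]
    · simpa using ht.ne'
    · rw [Multiset.mem_cons, not_or]
      refine ⟨fun h => ?_, fun hm => hnm _ hm hnI⟩
      have := congrArg Complex.im h
      simp at this
      linarith

/-- The new roots `i + 1/4` and `i + 3/4` of the symbol enclose no integer, so its values at the
integers from `k` on stay positive and the image has no positive root. Their ratio tends to 1, so
the rescaled limit is `(1 - y)²`. -/
theorem add_cplx_pos (h : RootPair k Q n 0 c n' z' p' c')
    (hpos : ∀ j : ℕ, 0 < Q.eval ((j : ℝ) + k)) :
    ∃ Q' : ℝ[X], (∀ j : ℕ, 0 < Q'.eval ((j : ℝ) + k)) ∧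
      RootPair k Q' n 0 (c + 2) n' z' (p' + 2) c' := by
  set r : ℕ → ℝ := fun i => i + 1 / 4 with hrdef
  set s : ℕ → ℝ := fun i => i + 3 / 4 with hsdef
  have hrpos : ∀ i, 0 < r i := fun i => by positivity
  have hspos : ∀ i, 0 < s i := fun i => by positivity
  have hr : Tendsto r atTop atTop := tendsto_atTop_add_const_right _ _ tendsto_natCast_atTop_atTop
  have hs : Tendsto s atTop atTop := tendsto_atTop_add_const_right _ _ tendsto_natCast_atTop_atTop
  have hrs : Tendsto (fun i => r i / s i) atTop (𝓝 1) := by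
    have h1 : Tendsto (fun i => 1 - (1 / 2) / s i) atTop (𝓝 (1 - 0)) :=
      tendsto_const_nhds.sub (tendsto_const_nhds.div_atTop hs)
    rw [sub_zero] at h1
    refine h1.congr fun i => ?_
    have := (hspos i).ne'
    field_simp
    simp only [hrdef, hsdef]
    ring
  set u : ℕ → ℝ := fun i => -(1 / r i + 1 / s i) with hudef
  set v : ℕ → ℝ := fun i => 1 / r i * (1 / s i) with hvdef
  have hr0 : Tendsto (fun i => 1 / r i) atTop (𝓝 0) := tendsto_const_nhds.div_atTop hr
  have hs0 : Tendsto (fun i => 1 / s i) atTop (𝓝 0) := tendsto_const_nhds.div_atTop hs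
  have hu0 : Tendsto u atTop (𝓝 0) := by
    have := (hr0.add hs0).neg
    rwa [add_zero, neg_zero] at this
  have hv0 : Tendsto v atTop (𝓝 0) := by
    have := hr0.mul hs0
    rwa [mul_zero] at this
  have hu : Tendsto (fun i => r i * u i) atTop (𝓝 (-2)) := by
    have h1 : Tendsto (fun i => -(1 + r i / s i)) atTop (𝓝 (-(1 + 1))) :=
      (tendsto_const_nhds.add hrs).neg
    norm_num at h1
    refine h1.congr fun i => ?_
    have := (hspos i).ne'
    have := (hrpos i).ne'
    simp only [hudef]
    field_simp
    ring
  have hv : Tendsto (fun i => r i ^ 2 * v i) atTop (𝓝 1) := by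
    refine hrs.congr fun i => ?_
    have := (hspos i).ne'
    have := (hrpos i).ne'
    simp only [hvdef]
    field_simp
  have hfac : ∀ i, (1 + C (u i) * X + C (v i) * X ^ 2 : ℝ[X]) =
      C (v i) * ((X - C (r i)) * (X - C (s i))) := by
    intro i
    have h1 : v i * (r i * s i) = 1 := by
      have := (hspos i).ne'
      have := (hrpos i).ne'
      simp only [hvdef]
      field_simp
    have h2 : u i = - (v i * (r i + s i)) := by
      have := (hspos i).ne'
      have := (hrpos i).ne'
      simp only [hvdef, hudef]
      field_simp
      ring
    have h1' : (C (v i) * (C (r i) * C (s i)) : ℝ[X]) = 1 := by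
      rw [← C_mul, ← C_mul, h1, C_1]
    rw [h2]
    simp only [C_neg, C_mul, C_add]
    linear_combination -h1'
  have hvpos : ∀ i, 0 < v i := fun i =>
    mul_pos (one_div_pos.2 (hrpos i)) (one_div_pos.2 (hspos i))
  have hpos' : ∀ i, ∀ j : ℕ, 0 < ((1 + C (u i) * X + C (v i) * X ^ 2) * Q).eval ((j : ℝ) + k) := by
    intro i j
    rw [hfac, eval_mul]
    refine mul_pos ?_ (hpos j)
    simp only [eval_mul, eval_C, eval_sub, eval_X]
    refine mul_pos (hvpos i) ?_
    simp only [hrdef, hsdef]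
    rcases le_or_gt (j + k) i with hji | hji
    · have : (j : ℝ) + k ≤ i := by exact_mod_cast hji
      exact mul_pos_of_neg_of_neg (by linarith) (by linarith)
    · have : (i : ℝ) + 1 ≤ (j : ℝ) + k := by exact_mod_cast hji
      exact mul_pos (by linarith) (by linarith)
  have hsym : ∀ i, symbolPoly k ((1 + C (u i) * X + C (v i) * X ^ 2) * Q) = _ :=
    fun i => symbolPoly_quadratic_mul k Q (u i) (v i)
  have hF := PolyTendsto.add_smul_add_smul hu0 hv0
    (symbolPoly k Q) (eulerOp k (symbolPoly k Q)) (eulerOp k (eulerOp k (symbolPoly k Q)))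
  have hlarge : ∀ M : ℝ, ∀ᶠ i in atTop, ∃ w ∈ (symbolPoly k Q +
      u i • eulerOp k (symbolPoly k Q) +
        v i • eulerOp k (eulerOp k (symbolPoly k Q))).aroots ℂ, M < ‖w‖ ∧ w.im ≠ 0 := by
    -- A root within `r/2` of `r` has positive real part; being real would contradict positivity of
    -- the image on the positive axis.
    intro M
    filter_upwards [exists_large_root_quadratic k h.symbol_ne_zero hr hu hv (y := ((1 : ℝ) : ℂ))
      (by push_cast; norm_num), hr.eventually_gt_atTop (2 * M)] with i ⟨w, hw, hwi⟩ hiM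
    obtain ⟨h1, h2⟩ := large_of_near (by norm_num) hwi
    refine ⟨w, hw, by linarith, fun hi => ?_⟩
    have hre : 0 < w.re := by linarith [hrpos i]
    have hz' : ((w.re : ℝ) : ℂ) = w := Complex.ext (by simp) (by simp [hi])
    rw [← hz', ← hsym] at hw
    exact notMem_aroots_ofReal
      (symbolPoly_eval_pos k (hpos' i) hre.le (pow_pos hre k)).ne' hw
  obtain ⟨i, hsc, hnr, hns⟩ := ((h.symbol.perturb_cplx hF h.symbol_ne_zero
    (Eventually.of_forall fun t => natDegree_quadratic_le k _ _ _) hlarge).and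
    ((eventually_norm_lt hr ((descPochhammer ℝ k * Q).aroots ℂ)).and
      (eventually_norm_lt hs ((descPochhammer ℝ k * Q).aroots ℂ)))).exists
  rw [← hsym] at hsc
  refine ⟨(1 + C (u i) * X + C (v i) * X ^ 2) * Q, hpos' i, ?_, ?_, hsc, ?_⟩
  · refine mul_ne_zero (fun h0 => ?_) h.ne_zero
    have := congrArg (eval 0) h0
    simp at this
  · intro h0
    rw [h0] at hsc
    have := hsc.card_eq
    simp at this
  · have hB : (1 + C (u i) * X + C (v i) * X ^ 2 : ℝ[X]).map (algebraMap ℝ ℂ) =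
        C ((v i : ℝ) : ℂ) * ((X - C ((r i : ℝ) : ℂ)) * (X - C ((s i : ℝ) : ℂ))) := by
      rw [hfac]
      simp
    have hvc : ((v i : ℝ) : ℂ) ≠ 0 := by exact_mod_cast (hvpos i).ne'
    have hnot : ∀ x : ℝ, 0 < x → (∀ w ∈ (descPochhammer ℝ k * Q).aroots ℂ, ‖w‖ < x) →
        (x : ℂ) ∉ (descPochhammer ℝ k * Q).aroots ℂ := by
      intro x hx hw hm
      have := hw _ hm
      rw [Complex.norm_real, Real.norm_eq_abs, abs_of_pos hx] at this
      exact lt_irrefl _ this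
    rw [quadratic_mul_comm, aroots_quadratic_mul h.prod_ne_zero hvc hB]
    refine (h.roots.cons_pos (Complex.ofReal_im _) ?_ (hnot _ (hspos i) hns)).cons_pos
      (Complex.ofReal_im _) ?_ ?_
    · simpa using hspos i
    · simpa using hrpos i
    · rw [Multiset.mem_cons, not_or]
      refine ⟨fun h => ?_, hnot _ (hrpos i) hnr⟩
      have : r i = s i := by exact_mod_cast h
      simp only [hrdef, hsdef] at this
      linarith

end RootPair

/-! ### Recovering the composition factors from the roots of `P`. -/

theorem iteratedDeriv_exp_mul_linear (α β : ℂ) (j : ℕ) :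
    iteratedDeriv j (fun x => Complex.exp x * (α + β * x)) =
      fun x => Complex.exp x * (α + j * β + β * x) := by
  induction j with
  | zero => simp
  | succ j ih =>
    rw [iteratedDeriv_succ, ih]
    funext x
    have h1 : HasDerivAt (fun x : ℂ => α + j * β + β * x) β x := by
      simpa using ((hasDerivAt_id x).const_mul β).const_add (α + j * β)
    refine ((Complex.hasDerivAt_exp x).mul h1).deriv.trans ?_
    push_cast
    ring

open Classical in
theorem kappa_eq (a : ℂ) : kappa a = fun x => Complex.exp x *
    ((if a = 0 then 0 else 1) + (if a = 0 then 1 else 1 / a) * x) := by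
  funext x
  rw [kappa]
  split_ifs
  · simp
  · ring

theorem differentiable_kappa (a : ℂ) : Differentiable ℂ (kappa a) := by
  rw [kappa_eq]
  fun_prop

open Classical in
/-- The polynomial whose values at `j` are the coefficients of `κ_{-r}`. -/
noncomputable def kappaSymbol (r : ℂ) : ℂ[X] := if r = 0 then X else C (1 / -r) * (X - C r)

theorem expCoeff_kappa (r : ℂ) (j : ℕ) : expCoeff (kappa (-r)) j = (kappaSymbol r).eval (j : ℂ) := by
  rw [expCoeff, kappa_eq, iteratedDeriv_exp_mul_linear, kappaSymbol]
  by_cases hr : r = 0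
  · simp [hr]
  · simp [hr]
    field_simp
    ring

theorem prod_kappaSymbol (M : Multiset ℂ) : ∃ κ : ℂ, κ ≠ 0 ∧ ∃ G : ℂ[X], G.eval 0 = 1 ∧
    (M.map kappaSymbol).prod = X ^ (M.count 0) * G ∧
    (M.map fun r => X - C r).prod = C κ * (M.map kappaSymbol).prod := by
  induction M using Multiset.induction with
  | empty => exact ⟨1, one_ne_zero, 1, by simp, by simp, by simp⟩
  | cons r M ih =>
    obtain ⟨κ, hκ, G, hG, h1, h2⟩ := ih
    by_cases hr : r = 0
    · subst hr
      refine ⟨κ, hκ, G, hG, ?_, ?_⟩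
      · rw [Multiset.map_cons, Multiset.prod_cons, h1, Multiset.count_cons_self, kappaSymbol,
          if_pos rfl]
        ring
      · rw [Multiset.map_cons, Multiset.prod_cons, h2, Multiset.map_cons, Multiset.prod_cons,
          kappaSymbol, if_pos rfl, C_0]
        ring
    · refine ⟨-r * κ, mul_ne_zero (neg_ne_zero.2 hr) hκ, C (1 / -r) * (X - C r) * G, ?_, ?_, ?_⟩
      · simp [hG, hr]
      · rw [Multiset.map_cons, Multiset.prod_cons, h1, Multiset.count_cons_of_ne (Ne.symm hr),
          kappaSymbol, if_neg hr]
        ring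
      · have h3 : (C (-r) * C (1 / -r) : ℂ[X]) = 1 := by
          rw [← C_mul, mul_one_div_cancel (neg_ne_zero.2 hr), C_1]
        rw [Multiset.map_cons, Multiset.prod_cons, h2, Multiset.map_cons, Multiset.prod_cons,
          kappaSymbol, if_neg hr, C_mul]
        linear_combination -(C κ * (X - C r) * (M.map kappaSymbol).prod) * h3

/-- The product of the symbols of the `κ`'s has lowest coefficient 1, so the scalar is the lowest
non-zero coefficient of `P`, which is real. -/
theorem exists_real_scale_prod_kappaSymbol {P : ℝ[X]} (hP : P ≠ 0) : ∃ γ : ℝ, γ ≠ 0 ∧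
    P.map (algebraMap ℝ ℂ) = C (γ : ℂ) * ((P.aroots ℂ).map kappaSymbol).prod := by
  obtain ⟨κ, hκ, G, hG, h1, h2⟩ := prod_kappaSymbol (P.aroots ℂ)
  have h3 := (IsAlgClosed.splits (P.map (algebraMap ℝ ℂ))).eq_prod_roots
  rw [← aroots_def, h2, ← mul_assoc, ← C_mul] at h3
  set γ : ℂ := (P.map (algebraMap ℝ ℂ)).leadingCoeff * κ with hγ
  have hγ0 : γ ≠ 0 := mul_ne_zero (leadingCoeff_ne_zero.2 (map_ne_zero hP)) hκ
  have h4 : ((P.coeff ((P.aroots ℂ).count 0) : ℝ) : ℂ) = γ := by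
    have h5 := congrArg (fun F : ℂ[X] => F.coeff ((P.aroots ℂ).count 0)) h3
    have h6 := coeff_X_pow_mul G ((P.aroots ℂ).count 0) 0
    rw [zero_add, coeff_zero_eq_eval_zero, hG] at h6
    simpa only [coeff_map, h1, coeff_C_mul, h6, mul_one, Complex.coe_algebraMap] using h5
  refine ⟨P.coeff ((P.aroots ℂ).count 0), fun h0 => hγ0 ?_, ?_⟩
  · rw [← h4, h0, Complex.ofReal_zero]
  · rw [h4]
    exact h3

theorem aroots_map_conj (F : ℝ[X]) : (F.aroots ℂ).map (starRingEnd ℂ) = F.aroots ℂ := by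
  rw [aroots_def, ← (IsAlgClosed.splits (F.map (algebraMap ℝ ℂ))).roots_map, Polynomial.map_map]
  congr 2
  ext x
  simp

theorem exists_fin_map_eq {n : ℕ} {M : Multiset ℂ} (h : Multiset.card M = n) :
    ∃ g : Fin n → ℂ, (Finset.univ : Finset (Fin n)).val.map g = M := by
  obtain ⟨L, rfl⟩ : ∃ L : List ℂ, M = L := ⟨M.toList, M.coe_toList.symm⟩
  rw [Multiset.coe_card] at h
  subst h
  exact ⟨L.get, by rw [Fin.univ_val_map, List.ofFn_get]⟩

/-- Take `R` to be the image of `P/γ`, the exact product of the factor symbols. The hypothesis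
`hsum` matches the number of factors with `deg R`. -/
theorem RootPair.realizable {k n p c n' z' p' c' : ℕ} {Q : ℝ[X]}
    (h : RootPair k Q n p c n' z' p' c') (hsum : n + k + p + c = n' + z' + p' + c') :
    Realizable n k p c n' z' p' c' := by
  set P := descPochhammer ℝ k * Q with hPdef
  obtain ⟨γ, hγ, hfac⟩ := exists_real_scale_prod_kappaSymbol h.prod_ne_zero
  rw [← hPdef] at hfac
  set R := symbolPoly 0 (γ⁻¹ • P) with hRdef
  have hR : R = γ⁻¹ • (X ^ k * symbolPoly k Q) := by
    rw [hRdef, symbolPoly_smul, symbolPoly_zero_descPochhammer_mul]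
  have hXS : (X ^ k * symbolPoly k Q : ℝ[X]) ≠ 0 := mul_ne_zero (by simp) h.symbol_ne_zero
  have hroots : SignCounts (R.aroots ℂ) n k p c := by
    rw [hR, aroots_smul_nonzero _ (inv_ne_zero hγ), aroots_mul hXS, aroots_X_pow]
    simpa using h.symbol.nsmul_zero_add k
  have hcard : Multiset.card (P.aroots ℂ) = R.natDegree := by
    rw [h.roots.card_eq, hroots.natDegree_eq, hsum]
  obtain ⟨g, hg⟩ := exists_fin_map_eq hcard
  refine ⟨R, fun i => -g i, ?_, ⟨fun i => differentiable_kappa _, fun x => ?_⟩,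
    hroots.hasCounts (aroots_map_conj R), ?_⟩
  · rw [hR]
    exact smul_ne_zero (inv_ne_zero hγ) hXS
  · have h1 := hasSum_symbolPoly (γ⁻¹ • P) x
    rw [← hRdef, ← eval_map_algebraMap] at h1
    refine HasSum.of_eq h1 fun j => ?_
    congr 2
    have h2 := congrArg (eval (j : ℂ)) hfac
    rw [eval_map_algebraMap, ← Complex.ofReal_natCast, aeval_ofReal, eval_mul (p := C (γ : ℂ)), eval_C,
      ← hg, Multiset.map_map, eval_multiset_prod, Multiset.map_map] at h2
    rw [eval_smul, smul_eq_mul, Complex.ofReal_mul, h2, ← mul_assoc, ← Complex.ofReal_mul,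
      inv_mul_cancel₀ hγ, Complex.ofReal_one, one_mul]
    exact Finset.prod_congr rfl fun i _ => by
      rw [expCoeff_kappa]
      simp
  · have h1 : (Finset.univ : Finset (Fin R.natDegree)).val.map (fun i => - -g i) = P.aroots ℂ := by
      simpa using hg
    rw [h1]
    exact h.roots.hasCounts (aroots_map_conj P)

/-! ### Assembling the four cases. -/

namespace RootPair

variable {k n p c n' z' p' c' : ℕ} {Q : ℝ[X]}

theorem extend (h : RootPair k Q n p c n' z' p' c') (a m e : ℕ) :
    ∃ Q', RootPair k Q' (n + a) (p + m) (c + 2 * e) (n' + a) z' (p' + m) (c' + 2 * e) := by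
  induction a with
  | succ a ih =>
    obtain ⟨Q', hQ'⟩ := ih
    exact hQ'.add_neg
  | zero =>
    induction m with
    | succ m ih =>
      obtain ⟨Q', hQ'⟩ := ih
      exact hQ'.add_pos
    | zero =>
      induction e with
      | succ e ih =>
        obtain ⟨Q', hQ'⟩ := ih
        exact hQ'.add_cplx
      | zero => exact ⟨Q, h⟩

theorem extend_cplx_pos (h : RootPair k Q n 0 c n' z' p' c')
    (hpos : ∀ j : ℕ, 0 < Q.eval ((j : ℝ) + k)) (e : ℕ) :
    ∃ Q' : ℝ[X], (∀ j : ℕ, 0 < Q'.eval ((j : ℝ) + k)) ∧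
      RootPair k Q' n 0 (c + 2 * e) n' z' (p' + 2 * e) c' := by
  induction e with
  | zero => exact ⟨Q, hpos, h⟩
  | succ e ih =>
    obtain ⟨Q', hpos', hQ'⟩ := ih
    exact hQ'.add_cplx_pos hpos'

end RootPair

/-- Realizability when zero is a root of both polynomials. -/
theorem realizable_of_zero (k a b e g m q₁ f : ℕ) :
    Realizable (a + b + 2 * e + q₁) (k + 1) m (2 * g + 2 * f)
      q₁ (a + 1) (k + b + 2 * g + m) (2 * e + 2 * f) := by
  obtain ⟨Q, hQ⟩ := SmallRoots.exists_smallRoots k a b e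
  have h1 : RootPair (k + 1) (X ^ a * Q) (a + b + 2 * e) 0 0 0 (a + 1) (k + b) (2 * e) :=
    ⟨mul_ne_zero (by simp) hQ.ne_zero, hQ.symbol_ne, hQ.symbol, hQ.signCounts_descPochhammer_mul k⟩
  -- These pairs come first: they need positive values at the integers and an image without positive
  -- roots, which later factors may destroy.
  obtain ⟨Q₁, -, h2⟩ := h1.extend_cplx_pos hQ.eval_add_pos g
  obtain ⟨Q₂, h3⟩ := h2.extend q₁ m f
  have := h3.realizable (by ring)
  simpa using this

theorem exists_positive_symbol {b : ℕ} (hb : Even b) (e : ℕ) : ∃ Q : ℝ[X], 0 < Q.eval 0 ∧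
    (∀ x, 1 ≤ x → 0 < Q.eval x) ∧ SignCounts (Q.aroots ℂ) 0 0 b (2 * e) ∧
    SignCounts ((symbolPoly 0 Q).aroots ℂ) (b + 2 * e) 0 0 0 := by
  rcases e with _ | e
  · rcases b with _ | b
    · refine ⟨1, by simp, by simp, by simpa using SignCounts.zero, ?_⟩
      simpa [symbolPoly_one] using SignCounts.zero
    · obtain ⟨Q, hQ⟩ := SmallRoots.exists_smallRoots 0 0 b 0
      exact hQ.step_real_zero (by rw [← Nat.not_even_iff_odd]; exact Nat.even_add_one.1 hb)
  · obtain ⟨Q, hQ⟩ := SmallRoots.exists_smallRoots 0 1 b e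
    exact hQ.step_cplx_zero hb

/-- Realizability when zero is a root of neither polynomial. -/
theorem realizable_of_nonzero {b : ℕ} (hb : Even b) (e g m q₁ f : ℕ) :
    Realizable (b + 2 * e + q₁) 0 m (2 * g + 2 * f) q₁ 0 (b + 2 * g + m) (2 * e + 2 * f) := by
  obtain ⟨Q, hQ0, hQ1, hr, hs⟩ := exists_positive_symbol hb e
  have hpos : ∀ j : ℕ, 0 < Q.eval ((j : ℝ) + (0 : ℕ)) := by
    intro j
    rcases Nat.eq_zero_or_pos j with rfl | hj
    · simpa using hQ0
    · refine hQ1 _ ?_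
      have : (1 : ℝ) ≤ j := by exact_mod_cast hj
      simpa using this
  have h1 : RootPair 0 Q (b + 2 * e) 0 0 0 0 b (2 * e) := by
    refine ⟨?_, ?_, hs, by simpa using hr⟩
    · rintro rfl
      simp at hQ0
    · intro h0
      have := symbolPoly_zero_eval_pos hQ0 hQ1 le_rfl
      simp [h0] at this
  obtain ⟨Q₁, -, h2⟩ := h1.extend_cplx_pos hpos g
  obtain ⟨Q₂, h3⟩ := h2.extend q₁ m f
  have := h3.realizable (by ring)
  simpa using this

theorem theorem2 :
    -- Case 1)
    (∀ k q m q₁ k₁ kC qC : ℕ, 1 ≤ k → 1 ≤ q → Even kC → Even qC →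
      Realizable (q - 1 + q₁ + (qC + k₁)) k m kC
                 q₁ q (k - 1 + m + (kC + k₁)) qC) ∧
    -- Case 2), where `r = kC + k₁` is even
    (∀ m q₁ k₁ kC qC : ℕ, Even kC → Even qC → Even (kC + k₁) →
      Realizable (q₁ + (qC + k₁)) 0 m kC
                 q₁ 0 (m + (kC + k₁)) qC) ∧
    -- Case 3)
    (∀ k q m q₁ r s δ : ℕ, 1 ≤ k → 1 ≤ q → 0 < δ → Even (r + δ) → Even (s + δ) →
      Realizable (q - 1 + q₁ + s) k m (r + δ)
                 q₁ q (k - 1 + m + r) (s + δ)) ∧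
    -- Case 4), where `r` is even
    (∀ m q₁ r s δ : ℕ, 0 < δ → Even (r + δ) → Even (s + δ) → Even r →
      Realizable (q₁ + s) 0 m (r + δ)
                 q₁ 0 (m + r) (s + δ)) := by
  refine ⟨?_, ?_, ?_, ?_⟩
  · rintro k q m q₁ k₁ kC qC hk hq ⟨g, rfl⟩ ⟨e, rfl⟩
    convert realizable_of_zero (k - 1) (q - 1) k₁ e g m q₁ 0 using 1 <;> omega
  · rintro m q₁ k₁ kC qC ⟨g, rfl⟩ ⟨e, rfl⟩ hr
    have hk : Even k₁ := (Nat.even_add.1 hr).1 ⟨g, rfl⟩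
    convert realizable_of_nonzero hk e g m q₁ 0 using 1 <;> omega
  · intro k q m q₁ r s δ hk hq _ hr hs
    rw [Nat.even_iff] at hr hs
    -- Here `r`, `s`, `δ` have equal parity. When they are odd, one small positive root absorbs the
    -- odd units of `r` and `s`, and rounding `δ` up restores the number of non-real roots.
    convert realizable_of_zero (k - 1) (q - 1) (δ % 2) (s / 2) (r / 2) m q₁ ((δ + 1) / 2)
      using 1 <;> omega
  · intro m q₁ r s δ _ hr hs hre
    rw [Nat.even_iff] at hr hs hre
    convert realizable_of_nonzero (b := 0) (by simp) (s / 2) (r / 2) m q₁ (δ / 2)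
      using 1 <;> omega
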